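/- Let $d\ge 1$ be an integer and $\alpha\in(0,2)$. For $t>0$ let $p_t$ be the function on $\mathbf R^d$ with Fourier transform $\int_{\mathbf R^d} e^{-i\xi\cdot x}p_t(x)\,dx=e^{-t|\xi|^\alpha}$, and let $P_tf=f*p_t$. For $1\le p<\infty$ we write $f\in\mathscr D(L_S,L^p)$ if $f\in L^p(\mathbf R^d)$ (complex-valued) and the limit $L_Sf=\lim_{t\to0^+}\frac1t(P_tf-f)$ exists in the norm of $L^p(\mathbf R^d)$; thus $L_S=-(-\Delta)^{\alpha/2}$ in the semigroup sense. Elements of $L^p$ are identified when they agree almost everywhere; such an element is said to be continuous at a point, or uniformly continuous in a set, if it has a representative with this property. Let $B(x,R)$ be the open ball with centre $x$ and radius $R$, and $B(x,\infty)=\mathbf R^d$; let $\frac1\infty=0$. Let $1\le p<p'\le s'\le\infty$, let $0<r<R<\infty$ or $r=R=\infty$, let $x\in\mathbf R^d$, and let $f\in\mathscr D(L_S,L^p)$. (a) If $L_Sf$ is continuous at $x$, then $f$ is continuous at $x$. (b) If $\mathbf 1_{B(x,R)}L_Sf\in L^{p'}(\mathbf R^d)$ and $p'>\frac d\alpha$,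 then $f$ is uniformly continuous in $B(x,r)$. (c) If $\mathbf 1_{B(x,R)}L_Sf\in L^{p'}(\mathbf R^d)$ and $\frac1{s'}>\frac1{p'}-\frac\alpha d$, then $\mathbf 1_{B(x,r)}f\in L^{s'}(\mathbf R^d)$. -/

import Mathlib

open MeasureTheory Filter Topology
open scoped ENNReal FourierTransform

noncomputable section

/-- The kernel `p_t` on `ℝᵈ` whose Fourier transform, in the convention
`ξ ↦ ∫ exp (-i ξ·x) p_t x dx`, is `ξ ↦ exp (-t |ξ|^α)`. Mathlib's transform `𝓕` has
`exp (-2π i ξ·x)` in place of `exp (-i ξ·x)`, so that `p_t` is the inverse transform `𝓕⁻` of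
`ξ ↦ exp (-t |2π ξ|^α)`; that is, `p_t z = (2π)⁻ᵈ ∫ exp (i ξ·z) exp (-t |ξ|^α) dξ`.
The values are real; they are kept as complex numbers. -/
def stableKernel (d : ℕ) (α t : ℝ) : EuclideanSpace ℝ (Fin d) → ℂ :=
  𝓕⁻ (fun ξ : EuclideanSpace ℝ (Fin d) => ((Real.exp (-t * (2 * Real.pi * ‖ξ‖) ^ α) : ℝ) : ℂ))

/-- `P_t f = f * p_t`. -/
def stableSemigroup {d : ℕ} (α t : ℝ) (f : EuclideanSpace ℝ (Fin d) → ℂ) :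
    EuclideanSpace ℝ (Fin d) → ℂ :=
  convolution f (stableKernel d α t) (ContinuousLinearMap.mul ℂ ℂ) volume

/-- `f` belongs to the domain `D(L_S, L^p)` and `L_S f = g` (almost everywhere): both functions
are in `L^p`, and `(P_t f - f) / t` converges to `g` in the norm of `L^p` as `t → 0⁺`. -/
structure HasFracLaplacian {d : ℕ} (α : ℝ) (p : ℝ≥0∞) (f g : EuclideanSpace ℝ (Fin d) → ℂ) :
    Prop where
  memLp : MemLp f p volume
  memLp_image : MemLp g p volume
  tendsto : Tendsto
    (fun t : ℝ => eLpNorm (fun y => (stableSemigroup α t f y - f y) / (t : ℂ) - g y) p volume)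
    (𝓝[>] 0) (𝓝 0)

end

/-! With `V = ∫₀¹ p_s ds`, integrating `d/ds P_s f = P_s L f` over `(0, 1)` gives `f = P₁ f - V * L
f` almost everywhere. The formula is proved weakly: pairing with a test function turns convergence
in `L^p` into uniform convergence of bounded continuous functions, and the fundamental theorem of
calculus applies to the resulting scalar function of `s`.

Split `V` into its parts inside and outside a ball of radius `ε`. The outer part and `p₁` lie in
every `L^q`, so their convolutions with `L f` and `f` are uniformly continuous and lie in `L^s` for
all `s ≥ p`. The inner part lies in `L^q` whenever `1/q > 1 - α/d`, and near a point its convolution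
sees `L f` only within distance `ε`. Hölder's and Young's inequalities then give (b) and (c); (a) is
(b) with `p' = ∞` on a small ball.

The bounds on `V` interpolate between `p_s ≤ s^(-d/α) p₁(0)`, from scaling, and `p_s(z) ≤ C
|z|^(-d)`, which holds for any radially nonincreasing density of mass one. Monotonicity comes from
subordination: `1 - (1 - x)^(α/2)` has nonnegative coefficients with partial sums at most one, so
`exp (-l (1 - exp (-a|ξ|²))^(α/2))`, damped by a Gaussian, is a limit of nonnegative combinations of
Gaussians. With `a` of order `1/n` and `l` of order `n^(α/2)` these symbols tend to that of `p_t`,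
up to the damping, which is removed last. -/

/-! ### The binomial series of `1 - (1 - x)^β`. -/

/-- The signs of the coefficients of `(1 - x) ^ β` for `β ∈ (0, 1)`. -/
lemma neg_one_pow_mul_descPochhammer_nonneg {β : ℝ} (h0 : 0 < β) (h1 : β < 1) (k : ℕ) :
    0 ≤ (-1 : ℝ) ^ k * (descPochhammer ℤ (k + 1)).smeval β := by
  induction k with
  | zero => simpa using h0.le
  | succ k ih =>
    rw [descPochhammer_succ_right, Polynomial.smeval_mul, pow_succ]
    simp only [Polynomial.smeval_sub, Polynomial.smeval_X, Polynomial.smeval_natCast, pow_one,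
      nsmul_eq_mul, pow_zero, mul_one]
    have h2 : 0 ≤ ((k + 1 : ℕ) : ℝ) - β := by push_cast; linarith [(Nat.cast_nonneg k : (0:ℝ) ≤ k)]
    nlinarith [mul_nonneg ih h2]

lemma exists_hasSum_one_sub_one_sub_rpow {β : ℝ} (h0 : 0 < β) (h1 : β < 1) :
    ∃ b : ℕ → ℝ, (∀ k, 0 ≤ b k) ∧
      ∀ x : ℝ, 0 ≤ x → x < 1 → HasSum (fun k => b k * x ^ k) (1 - (1 - x) ^ β) := by
  -- The constant terms of `1` and of the binomial series cancel, so the coefficient at `k = 0` is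
  -- zero; the others change sign.
  refine ⟨fun k => if k = 0 then 0 else -(-1) ^ k * Ring.choose β k, fun k => ?_, fun x hx0 hx1 => ?_⟩
  · rcases k with _ | k
    · simp
    · have h := neg_one_pow_mul_descPochhammer_nonneg h0 h1 k
      rw [Ring.descPochhammer_eq_factorial_smul_choose, nsmul_eq_mul] at h
      have hf : (0 : ℝ) < ((k + 1).factorial : ℝ) := by positivity
      have h' : 0 ≤ ((k + 1).factorial : ℝ) * ((-1) ^ k * Ring.choose β (k + 1)) := by
        calc _ ≤ _ := h
          _ = _ := by ring
      have := nonneg_of_mul_nonneg_right h' hf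
      simp only [Nat.add_eq_zero_iff, one_ne_zero, and_false, if_false, pow_succ]
      linarith
  · have hs := (Real.one_add_rpow_hasFPowerSeriesOnBall_zero (a := β)).hasSum (y := -x) (by
      rw [← ENNReal.ofReal_one, Metric.eball_ofReal]; simp [abs_of_nonneg hx0, hx1])
    simp only [binomialSeries_apply, zero_add, smul_eq_mul, List.ofFn_const, List.prod_replicate]
      at hs
    have h2 : HasSum (fun k : ℕ => if k = 0 then (1:ℝ) else 0) 1 := hasSum_ite_eq 0 1
    rw [sub_eq_add_neg (1:ℝ) x]
    have he : (fun k : ℕ => (if k = 0 then 0 else -(-1) ^ k * Ring.choose β k) * x ^ k) =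
        fun k => (if k = 0 then (1 : ℝ) else 0) - Ring.choose β k * (-x) ^ k := by
      ext k
      rcases k with _ | k
      · simp
      · simp only [Nat.add_eq_zero_iff, one_ne_zero, and_false, if_false, neg_pow x (k + 1)]
        ring
    rw [he]
    exact h2.sub hs

/-- For `x < 1` a partial sum is at most `1 - (1 - x)^β ≤ 1`; let `x` increase to `1` in the finite
sum. Convergence of the series at `x = 1` is not needed. -/
lemma sum_le_one_of_hasSum_one_sub_one_sub_rpow {β : ℝ} {b : ℕ → ℝ} (hb : ∀ k, 0 ≤ b k)
    (hs : ∀ x : ℝ, 0 ≤ x → x < 1 → HasSum (fun k => b k * x ^ k) (1 - (1 - x) ^ β)) (K : ℕ) :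
    ∑ k ∈ Finset.range K, b k ≤ 1 := by
  have hc : Tendsto (fun x : ℝ => ∑ k ∈ Finset.range K, b k * x ^ k) (𝓝[<] 1)
      (𝓝 (∑ k ∈ Finset.range K, b k * 1 ^ k)) := by
    apply tendsto_nhdsWithin_of_tendsto_nhds
    exact (Continuous.tendsto (by fun_prop) 1)
  simp only [one_pow, mul_one] at hc
  refine le_of_tendsto hc ?_
  filter_upwards [Ioo_mem_nhdsLT (show (0:ℝ) < 1 by norm_num)] with x hx
  refine (sum_le_hasSum _ (fun k _ => by have := hb k; have := hx.1; positivity)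
    (hs x hx.1.le hx.2)).trans ?_
  have : 0 ≤ (1 - x) ^ β := Real.rpow_nonneg (by linarith [hx.2]) _
  linarith

/-! ### Symbols with nonnegative, radially nonincreasing inverse transform. -/

section Unimodal

variable {V : Type*} [NormedAddCommGroup V] [InnerProductSpace ℝ V] [FiniteDimensional ℝ V]
  [MeasurableSpace V] [BorelSpace V]

/-- The inverse Fourier transform of `F` is real, nonnegative, radially nonincreasing, and of total
mass at most `M`. -/
structure IsUnimodalSymbol (F : V → ℝ) (M : ℝ) : Prop where
  integrable : Integrable F
  im_eq_zero : ∀ z, (𝓕⁻ (fun ξ => (F ξ : ℂ)) z).im = 0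
  re_nonneg : ∀ z, 0 ≤ (𝓕⁻ (fun ξ => (F ξ : ℂ)) z).re
  re_anti : ∀ z w, ‖z‖ ≤ ‖w‖ →
    (𝓕⁻ (fun ξ => (F ξ : ℂ)) w).re ≤ (𝓕⁻ (fun ξ => (F ξ : ℂ)) z).re
  lintegral_le : ∫⁻ z, ENNReal.ofReal (𝓕⁻ (fun ξ => (F ξ : ℂ)) z).re ≤ ENNReal.ofReal M

lemma continuous_fourierInv_ofReal {F : V → ℝ} (hF : Integrable F) :
    Continuous (𝓕⁻ (fun ξ => (F ξ : ℂ))) := by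
  exact VectorFourier.fourierIntegral_continuous (μ := (volume : Measure V))
    Real.continuous_fourierChar (L := -(innerₗ V))
    (by simp only [LinearMap.neg_apply, innerₗ_apply_apply]; fun_prop) hF.ofReal

lemma tendsto_fourierInv_ofReal {F : ℕ → V → ℝ} {G : V → ℝ} {B : V → ℝ}
    (hF : ∀ n, AEStronglyMeasurable (F n) volume) (hB : Integrable B) (hFB : ∀ n ξ, |F n ξ| ≤ B ξ)
    (hlim : ∀ᵐ ξ, Tendsto (fun n => F n ξ) atTop (𝓝 (G ξ))) (z : V) :
    Tendsto (fun n => 𝓕⁻ (fun ξ => (F n ξ : ℂ)) z) atTop (𝓝 (𝓕⁻ (fun ξ => (G ξ : ℂ)) z)) := by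
  simp only [Real.fourierInv_eq]
  refine tendsto_integral_of_dominated_convergence B (fun n => ?_) hB (fun n => ?_) ?_
  · refine AEStronglyMeasurable.fun_smul ?_ ((Complex.continuous_ofReal.comp_aestronglyMeasurable (hF n)))
    have : Continuous fun v : V => Real.fourierChar (inner ℝ v z) :=
      Real.continuous_fourierChar.comp (by fun_prop)
    exact (Continuous.aestronglyMeasurable this)
  · filter_upwards with ξ
    simpa [Circle.norm_smul] using hFB n ξ
  · filter_upwards [hlim] with ξ hξ
    exact ((Complex.continuous_ofReal.tendsto _).comp hξ).const_smul _

/-- Dominated convergence makes the inverse transforms converge pointwise, so sign and monotonicity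
survive. The mass is controlled by Fatou's lemma, which is why the class only asks for an upper
bound on it. -/
lemma IsUnimodalSymbol.of_tendsto {F : ℕ → V → ℝ} {G : V → ℝ} {B : V → ℝ} {M : ℝ}
    (hF : ∀ n, IsUnimodalSymbol (F n) M) (hB : Integrable B) (hFB : ∀ n ξ, |F n ξ| ≤ B ξ)
    (hlim : ∀ᵐ ξ, Tendsto (fun n => F n ξ) atTop (𝓝 (G ξ))) : IsUnimodalSymbol G M := by
  have ht := tendsto_fourierInv_ofReal (fun n => (hF n).integrable.aestronglyMeasurable) hB hFB hlim
  have hre := fun z => (Complex.continuous_re.tendsto _).comp (ht z)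
  have him := fun z => (Complex.continuous_im.tendsto _).comp (ht z)
  refine ⟨?_, fun z => ?_, fun z => ?_, fun z w h => ?_, ?_⟩
  · refine hB.mono (aestronglyMeasurable_of_tendsto_ae atTop
      (fun n => (hF n).integrable.aestronglyMeasurable) hlim) ?_
    filter_upwards [hlim] with ξ hξ
    refine le_of_tendsto hξ.norm (Eventually.of_forall fun n => ?_)
    exact (hFB n ξ).trans (le_abs_self _)
  · refine tendsto_nhds_unique (him z) ?_
    simp only [Function.comp_def, (hF _).im_eq_zero]
    exact tendsto_const_nhds
  · exact ge_of_tendsto (hre z) (Eventually.of_forall fun n => (hF n).re_nonneg z)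
  · exact le_of_tendsto_of_tendsto (hre w) (hre z) (Eventually.of_forall fun n => (hF n).re_anti z w h)
  · calc _ = ∫⁻ z, liminf (fun n => ENNReal.ofReal (𝓕⁻ (fun ξ => (F n ξ : ℂ)) z).re) atTop := by
          refine lintegral_congr fun z => ?_
          exact ((ENNReal.tendsto_ofReal (hre z)).liminf_eq).symm
      _ ≤ liminf (fun n => ∫⁻ z, ENNReal.ofReal (𝓕⁻ (fun ξ => (F n ξ : ℂ)) z).re) atTop := by
          refine lintegral_liminf_le fun n => ?_
          exact (Complex.continuous_re.comp
            (continuous_fourierInv_ofReal (hF n).integrable)).measurable.ennreal_ofReal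
      _ ≤ ENNReal.ofReal M := by
          refine (liminf_le_liminf (Eventually.of_forall fun n => (hF n).lintegral_le)).trans ?_
          simp

lemma IsUnimodalSymbol.mono {F : V → ℝ} {M N : ℝ} (hF : IsUnimodalSymbol F M) (h : M ≤ N) :
    IsUnimodalSymbol F N :=
  { hF with lintegral_le := hF.lintegral_le.trans (ENNReal.ofReal_le_ofReal h) }

lemma IsUnimodalSymbol.zero : IsUnimodalSymbol (0 : V → ℝ) 0 := by
  have h : ∀ z, 𝓕⁻ (fun ξ : V => (((0 : V → ℝ) ξ : ℝ) : ℂ)) z = 0 := by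
    intro z; simp [Real.fourierInv_eq]
  refine ⟨integrable_zero _ _ _, fun z => ?_, fun z => ?_, fun z w _ => ?_, ?_⟩
  · rw [h, Complex.zero_im]
  · rw [h, Complex.zero_re]
  · rw [h, h]
  · simp only [h, Complex.zero_re, ENNReal.ofReal_zero, lintegral_zero, le_refl]

lemma fourierInv_ofReal_add {F G : V → ℝ} (hF : Integrable F) (hG : Integrable G) (z : V) :
    𝓕⁻ (fun ξ => ((F + G) ξ : ℂ)) z = 𝓕⁻ (fun ξ => (F ξ : ℂ)) z + 𝓕⁻ (fun ξ => (G ξ : ℂ)) z := by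
  simp only [Real.fourierInv_eq_fourier_neg]
  simp only [Real.fourier_eq, Pi.add_apply, Complex.ofReal_add, smul_add]
  rw [integral_add]
  · exact (Real.fourierIntegral_convergent_iff (-z)).2 hF.ofReal
  · exact (Real.fourierIntegral_convergent_iff (-z)).2 hG.ofReal

lemma IsUnimodalSymbol.add {F G : V → ℝ} {M N : ℝ} (hF : IsUnimodalSymbol F M)
    (hG : IsUnimodalSymbol G N) (hM : 0 ≤ M) (hN : 0 ≤ N) : IsUnimodalSymbol (F + G) (M + N) := by
  have h := fourierInv_ofReal_add hF.integrable hG.integrable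
  refine ⟨hF.integrable.add hG.integrable, fun z => ?_, fun z => ?_, fun z w hzw => ?_, ?_⟩
  · rw [h, Complex.add_im, hF.im_eq_zero, hG.im_eq_zero, add_zero]
  · rw [h, Complex.add_re]; exact add_nonneg (hF.re_nonneg z) (hG.re_nonneg z)
  · rw [h, h, Complex.add_re, Complex.add_re]
    exact add_le_add (hF.re_anti z w hzw) (hG.re_anti z w hzw)
  · simp only [h, Complex.add_re, ENNReal.ofReal_add (hF.re_nonneg _) (hG.re_nonneg _),
      ENNReal.ofReal_add hM hN]
    rw [lintegral_add_left]
    · exact add_le_add hF.lintegral_le hG.lintegral_le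
    · exact (Complex.continuous_re.comp
            (continuous_fourierInv_ofReal hF.integrable)).measurable.ennreal_ofReal

lemma IsUnimodalSymbol.const_mul {F : V → ℝ} {M c : ℝ} (hF : IsUnimodalSymbol F M) (hc : 0 ≤ c) :
    IsUnimodalSymbol (fun ξ => c * F ξ) (c * M) := by
  have h : ∀ z, 𝓕⁻ (fun ξ => ((c * F ξ : ℝ) : ℂ)) z = c * 𝓕⁻ (fun ξ => (F ξ : ℂ)) z := by
    intro z
    simp only [Real.fourierInv_eq, ← integral_const_mul, Complex.ofReal_mul, Circle.smul_def,
      smul_eq_mul]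
    congr with ξ
    ring
  refine ⟨hF.integrable.const_mul c, fun z => ?_, fun z => ?_, fun z w hzw => ?_, ?_⟩
  · rw [h, Complex.im_ofReal_mul, hF.im_eq_zero, mul_zero]
  · rw [h, Complex.re_ofReal_mul]; exact mul_nonneg hc (hF.re_nonneg z)
  · rw [h, h, Complex.re_ofReal_mul, Complex.re_ofReal_mul]
    exact mul_le_mul_of_nonneg_left (hF.re_anti z w hzw) hc
  · simp only [h, Complex.re_ofReal_mul, ENNReal.ofReal_mul hc]
    rw [lintegral_const_mul']
    · gcongr; exact hF.lintegral_le
    · simp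

lemma isUnimodalSymbol_gaussian {b : ℝ} (hb : 0 < b) :
    IsUnimodalSymbol (fun ξ : V => Real.exp (-b * ‖ξ‖ ^ 2)) 1 := by
  set n : ℝ := Module.finrank ℝ V / 2 with hn
  have h : ∀ z : V, 𝓕⁻ (fun ξ : V => ((Real.exp (-b * ‖ξ‖ ^ 2) : ℝ) : ℂ)) z =
      (((Real.pi / b) ^ n * Real.exp (-(Real.pi ^ 2 / b) * ‖z‖ ^ 2) : ℝ) : ℂ) := by
    intro z
    rw [Real.fourierInv_eq_fourier_neg]
    have := fourier_gaussian_innerProductSpace (V := V) (b := (b : ℂ)) (by simpa using hb) (-z)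
    push_cast
    rw [this, Complex.ofReal_cpow (by positivity)]
    push_cast
    simp only [norm_neg, hn]
    push_cast
    congr 2
    ring
  have hi : Integrable (fun ξ : V => Real.exp (-b * ‖ξ‖ ^ 2)) := by
    have := GaussianFourier.integrable_cexp_neg_mul_sq_norm_add (V := V) (b := (b : ℂ)) (by simpa using hb) 0 0
    have := this.re
    refine this.congr (Eventually.of_forall fun ξ => ?_)
    simp only [zero_mul, add_zero]
    norm_cast
  refine ⟨hi, fun z => ?_, fun z => ?_, fun z w hzw => ?_, ?_⟩
  · rw [h, Complex.ofReal_im]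
  · rw [h, Complex.ofReal_re]; positivity
  · rw [h, h, Complex.ofReal_re, Complex.ofReal_re]
    gcongr ?_ * Real.exp ?_
    have : 0 < Real.pi ^ 2 / b := by positivity
    nlinarith [pow_le_pow_left₀ (norm_nonneg z) hzw 2]
  · simp only [h, Complex.ofReal_re]
    have hc : 0 < Real.pi ^ 2 / b := by positivity
    have hint := GaussianFourier.integral_rexp_neg_mul_sq_norm (V := V) hc
    rw [← ofReal_integral_eq_lintegral_ofReal]
    · rw [integral_const_mul, hint, ← Real.mul_rpow (by positivity) (by positivity)]
      rw [show Real.pi / b * (Real.pi / (Real.pi ^ 2 / b)) = 1 by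
        have := Real.pi_pos; field_simp]
      simp
    · refine Integrable.const_mul ?_ _
      by_contra hcon
      rw [integral_undef hcon] at hint
      have : 0 < (Real.pi / (Real.pi ^ 2 / b)) ^ ((Module.finrank ℝ V : ℝ) / 2) := by
        have := Real.pi_pos
        positivity
      linarith
    · filter_upwards with z
      positivity

/-- Polynomials with nonnegative coefficients in `exp (-a |ξ|²)`, times a Gaussian. -/
lemma isUnimodalSymbol_polynomial {a δ : ℝ} (ha : 0 ≤ a) (hδ : 0 < δ) (q : Polynomial ℝ)
    (hq : ∀ k, 0 ≤ q.coeff k) :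
    IsUnimodalSymbol (fun ξ : V => Real.exp (-δ * ‖ξ‖ ^ 2) * q.eval (Real.exp (-a * ‖ξ‖ ^ 2)))
      (q.eval 1) := by
  have key : ∀ s : Finset ℕ, IsUnimodalSymbol (fun ξ : V => ∑ k ∈ s, q.coeff k *
      Real.exp (-(δ + k * a) * ‖ξ‖ ^ 2)) (∑ k ∈ s, q.coeff k) := by
    intro s
    induction s using Finset.induction with
    | empty => simpa using! IsUnimodalSymbol.zero
    | insert k s hk ih =>
      simp only [Finset.sum_insert hk]
      have h1 := (isUnimodalSymbol_gaussian (V := V) (b := δ + k * a) (by positivity)).const_mul (hq k)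
      rw [mul_one] at h1
      exact h1.add ih (hq k) (Finset.sum_nonneg fun k _ => hq k)
  have := key (Finset.range (q.natDegree + 1))
  rw [Polynomial.eval_eq_sum_range]
  simp only [one_pow, mul_one]
  convert this using 2 with ξ
  rw [Polynomial.eval_eq_sum_range, Finset.mul_sum]
  refine Finset.sum_congr rfl fun k _ => ?_
  rw [← Real.exp_nat_mul, mul_left_comm, ← Real.exp_add]
  ring_nf

lemma integrable_exp_neg_mul_sq_norm {δ : ℝ} (hδ : 0 < δ) :
    Integrable (fun ξ : V => Real.exp (-δ * ‖ξ‖ ^ 2)) :=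
  (isUnimodalSymbol_gaussian hδ).integrable

lemma exp_neg_mul_le_one {a s : ℝ} (ha : 0 ≤ a) (hs : 0 ≤ s) : Real.exp (-a * s) ≤ 1 := by
  rw [Real.exp_le_one_iff]
  nlinarith [mul_nonneg ha hs]

/-- The symbol of a compound Poisson mixture of Gaussians. -/
lemma isUnimodalSymbol_exp_sum {a δ l : ℝ} (ha : 0 ≤ a) (hδ : 0 < δ) (hl : 0 ≤ l) {b : ℕ → ℝ}
    (hb : ∀ k, 0 ≤ b k) (hb1 : ∀ K, ∑ k ∈ Finset.range K, b k ≤ 1) (K : ℕ) :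
    IsUnimodalSymbol (fun ξ : V => Real.exp (-δ * ‖ξ‖ ^ 2) *
      Real.exp (-l * (1 - ∑ k ∈ Finset.range K, b k * Real.exp (-a * ‖ξ‖ ^ 2) ^ k))) 1 := by
  set S : ℝ → ℝ := fun x => ∑ k ∈ Finset.range K, b k * x ^ k with hS
  -- `exp (-l) (1 + l S / m)^m` is a polynomial with nonnegative coefficients, tends to `exp (-l (1
  -- - S))`, and is at most one on `[0, 1]` because `S ≤ 1` there.
  let q : ℕ → Polynomial ℝ := fun m => Polynomial.C (Real.exp (-l)) *
    (1 + Polynomial.C (l / m) * ∑ k ∈ Finset.range K, Polynomial.C (b k) * Polynomial.X ^ k) ^ m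
  have hqe : ∀ m x, (q m).eval x = Real.exp (-l) * (1 + l * S x / m) ^ m := by
    intro m x
    simp [q, hS, Polynomial.eval_finsetSum]
    rw [div_mul_eq_mul_div]
  have hqc : ∀ m k, 0 ≤ (q m).coeff k := by
    have hmul : ∀ p r : Polynomial ℝ, (∀ k, 0 ≤ p.coeff k) → (∀ k, 0 ≤ r.coeff k) →
        ∀ k, 0 ≤ (p * r).coeff k := by
      intro p r hp hr k
      rw [Polynomial.coeff_mul]
      exact Finset.sum_nonneg fun x _ => mul_nonneg (hp _) (hr _)
    have hC : ∀ c : ℝ, 0 ≤ c → ∀ k, 0 ≤ (Polynomial.C c).coeff k := by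
      intro c hc k
      rw [Polynomial.coeff_C]; split_ifs <;> simp [hc]
    have h1 : ∀ k, 0 ≤ (1 : Polynomial ℝ).coeff k := by simpa using hC 1 zero_le_one
    intro m
    refine hmul _ _ (hC _ (Real.exp_pos _).le) ?_
    have hbase : ∀ k, 0 ≤ (1 + Polynomial.C (l / m) *
        ∑ k ∈ Finset.range K, Polynomial.C (b k) * Polynomial.X ^ k : Polynomial ℝ).coeff k := by
      intro k
      rw [Polynomial.coeff_add]
      refine add_nonneg (h1 k) (hmul _ _ (hC _ (by positivity)) (fun j => ?_) k)
      rw [Polynomial.finsetSum_coeff]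
      refine Finset.sum_nonneg fun i _ => ?_
      rw [Polynomial.coeff_C_mul_X_pow]
      split_ifs
      · exact hb i
      · exact le_rfl
    have hpow : ∀ n k, 0 ≤ ((1 + Polynomial.C (l / m) *
        ∑ k ∈ Finset.range K, Polynomial.C (b k) * Polynomial.X ^ k : Polynomial ℝ) ^ n).coeff k := by
      intro n
      induction n with
      | zero => simpa using h1
      | succ n ih => rw [pow_succ]; exact hmul _ _ ih hbase
    exact hpow m
  have hS0 : ∀ x, 0 ≤ x → 0 ≤ S x := fun x hx =>
    Finset.sum_nonneg fun k _ => mul_nonneg (hb k) (pow_nonneg hx k)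
  have hS1 : ∀ x, 0 ≤ x → x ≤ 1 → S x ≤ 1 := fun x hx hx1 =>
    (Finset.sum_le_sum fun k _ => mul_le_of_le_one_right (hb k) (pow_le_one₀ hx hx1)).trans (hb1 K)
  have hq0 : ∀ m x, 0 ≤ x → 0 ≤ (q m).eval x := by
    intro m x hx
    rw [hqe]
    have := hS0 x hx
    positivity
  have hq1 : ∀ m x, 0 ≤ x → x ≤ 1 → (q m).eval x ≤ 1 := by
    intro m x hx hx1
    rw [hqe]
    have h0 := hS0 x hx
    have h1 := hS1 x hx hx1
    have : (1 + l * S x / m) ^ m ≤ Real.exp l := by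
      calc (1 + l * S x / m) ^ m ≤ (Real.exp (l * S x / m)) ^ m := by
            gcongr
            linarith [Real.add_one_le_exp (l * S x / m)]
        _ = Real.exp (m * (l * S x / m)) := (Real.exp_nat_mul _ _).symm
        _ ≤ Real.exp l := by
            gcongr
            rcases Nat.eq_zero_or_pos m with rfl | hm
            · simpa using hl
            · have : (m : ℝ) ≠ 0 := by positivity
              rw [mul_div_cancel₀ _ this]
              nlinarith
    calc Real.exp (-l) * (1 + l * S x / m) ^ m ≤ Real.exp (-l) * Real.exp l := by gcongr
      _ = 1 := by rw [← Real.exp_add]; simp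
  refine IsUnimodalSymbol.of_tendsto (F := fun m ξ => Real.exp (-δ * ‖ξ‖ ^ 2) *
    (q m).eval (Real.exp (-a * ‖ξ‖ ^ 2))) (fun m => ?_) (integrable_exp_neg_mul_sq_norm hδ)
    (fun m ξ => ?_) (Eventually.of_forall fun ξ => ?_)
  · exact (isUnimodalSymbol_polynomial ha hδ (q m) (hqc m)).mono (hq1 m 1 zero_le_one le_rfl)
  · have h0 := hq0 m _ (Real.exp_pos (-a * ‖ξ‖ ^ 2)).le
    rw [abs_of_nonneg (by positivity)]
    exact mul_le_of_le_one_right (Real.exp_pos _).le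
      (hq1 m _ (Real.exp_pos _).le (exp_neg_mul_le_one ha (by positivity)))
  · refine Tendsto.const_mul _ ?_
    simp only [hqe]
    have h := (Real.tendsto_one_add_div_pow_exp (l * S (Real.exp (-a * ‖ξ‖ ^ 2)))).const_mul
      (Real.exp (-l))
    rw [← Real.exp_add] at h
    convert h using 3
    ring

lemma isUnimodalSymbol_exp_rpow [Nontrivial V] {a δ l β : ℝ} (ha : 0 < a) (hδ : 0 < δ) (hl : 0 ≤ l)
    (h0 : 0 < β) (h1 : β < 1) :
    IsUnimodalSymbol (fun ξ : V => Real.exp (-δ * ‖ξ‖ ^ 2) *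
      Real.exp (-l * (1 - Real.exp (-a * ‖ξ‖ ^ 2)) ^ β)) 1 := by
  obtain ⟨b, hb, hs⟩ := exists_hasSum_one_sub_one_sub_rpow h0 h1
  have hb1 := sum_le_one_of_hasSum_one_sub_one_sub_rpow hb hs
  refine IsUnimodalSymbol.of_tendsto
    (fun K => isUnimodalSymbol_exp_sum ha.le hδ hl hb hb1 K) (integrable_exp_neg_mul_sq_norm hδ)
    (fun m ξ => ?_) ?_
  · rw [abs_of_nonneg (by positivity)]
    refine mul_le_of_le_one_right (Real.exp_pos _).le (exp_neg_mul_le_one hl (sub_nonneg.2 ?_))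
    refine (Finset.sum_le_sum fun k _ => mul_le_of_le_one_right (hb k) (pow_le_one₀
      (Real.exp_pos _).le ?_)).trans (hb1 m)
    exact exp_neg_mul_le_one ha.le (by positivity)
  -- At `ξ = 0` the series would be evaluated at `x = 1`, where `hs` says nothing; a point is null
  -- since `V` is nontrivial.
  · have : ∀ᵐ ξ : V, ξ ≠ 0 := by simp [ae_iff, measure_singleton]
    filter_upwards [this] with ξ hξ
    have hx : Real.exp (-a * ‖ξ‖ ^ 2) < 1 := by
      rw [Real.exp_lt_one_iff]
      have : 0 < a * ‖ξ‖ ^ 2 := by positivity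
      linarith
    have := (hs _ (Real.exp_pos _).le hx).tendsto_sum_nat
    refine Tendsto.const_mul _ ((Real.continuous_exp.tendsto _).comp ?_)
    have h2 := (this.const_sub 1).const_mul (-l)
    simpa using h2

/-- This is the derivative of `1 - exp (-s u)` at `u = 0`, taken along `u = 1/n`. -/
lemma tendsto_mul_one_sub_exp (s : ℝ) :
    Tendsto (fun n : ℕ => (n : ℝ) * (1 - Real.exp (-(s / n)))) atTop (𝓝 s) := by
  have h : HasDerivAt (fun u : ℝ => 1 - Real.exp (-(s * u))) s 0 := by
    have := (((hasDerivAt_id (0 : ℝ)).const_mul s).neg.exp).const_sub 1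
    simpa using this
  have h2 := h.tendsto_slope_zero_right
  have h3 : Tendsto (fun n : ℕ => ((n : ℝ))⁻¹) atTop (𝓝[>] 0) :=
    tendsto_inv_atTop_nhdsGT_zero.comp tendsto_natCast_atTop_atTop
  have := h2.comp h3
  refine this.congr fun n => ?_
  simp [div_eq_mul_inv]

/-- `exp (-t |2π ξ| ^ α)` is the Fourier transform of a nonnegative radially nonincreasing
function of mass at most one. -/
lemma isUnimodalSymbol_stable [Nontrivial V] {α t : ℝ} (ht : 0 < t) (h0 : 0 < α) (h2 : α < 2)
    (hint : Integrable (fun ξ : V => Real.exp (-t * (2 * Real.pi * ‖ξ‖) ^ α))) :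
    IsUnimodalSymbol (fun ξ : V => Real.exp (-t * (2 * Real.pi * ‖ξ‖) ^ α)) 1 := by
  have hle : ∀ ξ : V, Real.exp (-t * (2 * Real.pi * ‖ξ‖) ^ α) ≤ 1 := fun ξ =>
    exp_neg_mul_le_one ht.le (by have := Real.pi_pos; positivity)
  -- The factor `exp (-δ|ξ|²)` provides an integrable majorant for the approximating symbols, which
  -- do not decay by themselves. It is removed at the end, where the stable symbol is its own
  -- majorant.
  have hδ : ∀ δ : ℝ, 0 < δ → IsUnimodalSymbol (fun ξ : V => Real.exp (-δ * ‖ξ‖ ^ 2) *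
      Real.exp (-t * (2 * Real.pi * ‖ξ‖) ^ α)) 1 := by
    intro δ hδ
    -- With `N = n + 1`, `N (1 - exp (-|2πξ|²/N))` tends to `|2πξ|²`; raising it to the power `α/2`
    -- explains the factor `N^(α/2)`.
    refine IsUnimodalSymbol.of_tendsto (F := fun n ξ => Real.exp (-δ * ‖ξ‖ ^ 2) *
      Real.exp (-(t * ((n + 1 : ℕ) : ℝ) ^ (α / 2)) *
        (1 - Real.exp (-((2 * Real.pi) ^ 2 / (n + 1 : ℕ)) * ‖ξ‖ ^ 2)) ^ (α / 2)))
      (fun n => ?_) (integrable_exp_neg_mul_sq_norm hδ)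
      (fun n ξ => ?_) (Eventually.of_forall fun ξ => ?_)
    · refine isUnimodalSymbol_exp_rpow ?_ hδ (by positivity) (by linarith) (by linarith)
      have := Real.pi_pos
      positivity
    · rw [abs_of_nonneg (by positivity)]
      refine mul_le_of_le_one_right (Real.exp_pos _).le (exp_neg_mul_le_one (by positivity)
        (Real.rpow_nonneg (sub_nonneg.2 ?_) _))
      have := Real.pi_pos
      exact exp_neg_mul_le_one (by positivity) (by positivity)
    · refine Tendsto.const_mul _ ((Real.continuous_exp.tendsto _).comp ?_)
      have hs : (0 : ℝ) ≤ (2 * Real.pi * ‖ξ‖) ^ 2 := by positivity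
      have h := ((tendsto_mul_one_sub_exp ((2 * Real.pi * ‖ξ‖) ^ 2)).comp (tendsto_add_atTop_nat 1))
      have h3 := (h.rpow_const (p := α / 2) (Or.inr (by linarith))).const_mul (-t)
      have hpi := Real.pi_pos
      have e : ((2 * Real.pi * ‖ξ‖) ^ 2) ^ (α / 2) = (2 * Real.pi * ‖ξ‖) ^ α := by
        rw [← Real.rpow_natCast, ← Real.rpow_mul (by positivity)]
        congr 1; push_cast; ring
      rw [e] at h3
      refine h3.congr fun n => ?_
      simp only [Function.comp_apply]
      have e2 : -((2 * Real.pi * ‖ξ‖) ^ 2 / ((n + 1 : ℕ) : ℝ)) =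
        -((2 * Real.pi) ^ 2 / ((n + 1 : ℕ) : ℝ)) * ‖ξ‖ ^ 2 := by ring
      rw [e2, Real.mul_rpow (by positivity)]
      · ring
      · exact sub_nonneg.2 (exp_neg_mul_le_one (by positivity) (by positivity))
  refine IsUnimodalSymbol.of_tendsto (fun n : ℕ => hδ (1 / ((n : ℝ) + 1)) (by positivity)) hint
    (fun n ξ => ?_) (Eventually.of_forall fun ξ => ?_)
  · rw [abs_of_nonneg (by positivity)]
    exact mul_le_of_le_one_left (Real.exp_pos _).le
      (exp_neg_mul_le_one (by positivity) (by positivity))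
  · have h := (tendsto_one_div_add_atTop_nhds_zero_nat (𝕜 := ℝ)).neg.mul_const (‖ξ‖ ^ 2)
    have h4 := ((Real.continuous_exp.tendsto _).comp h).mul_const
      (Real.exp (-t * (2 * Real.pi * ‖ξ‖) ^ α))
    simpa using h4

end Unimodal

/-! ### The stable kernel: positivity, mass, scaling, semigroup law. -/

/-- The real values of `stableKernel`. -/
noncomputable def stableDensity (d : ℕ) (α t : ℝ) (z : EuclideanSpace ℝ (Fin d)) : ℝ :=
  (stableKernel d α t z).re

section Kernel

variable {d : ℕ} {α : ℝ}

lemma nontrivial_euclideanSpace_fin (hd : 1 ≤ d) : Nontrivial (EuclideanSpace ℝ (Fin d)) := by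
  have : Nonempty (Fin d) := ⟨⟨0, hd⟩⟩
  infer_instance

lemma integrable_exp_neg_mul_norm_rpow (hd : 1 ≤ d) (h0 : 0 < α) {t : ℝ} (ht : 0 < t) :
    Integrable (fun ξ : EuclideanSpace ℝ (Fin d) =>
      Real.exp (-t * (2 * Real.pi * ‖ξ‖) ^ α)) := by
  have := nontrivial_euclideanSpace_fin hd
  have hpi := Real.pi_pos
  refine (integrable_fun_norm_addHaar (E := EuclideanSpace ℝ (Fin d)) volume
    (f := fun y : ℝ => Real.exp (-t * (2 * Real.pi * y) ^ α))).2 ?_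
  have h := integrableOn_rpow_mul_exp_neg_mul_rpow (p := α)
    (s := ((Module.finrank ℝ (EuclideanSpace ℝ (Fin d)) - 1 : ℕ) : ℝ))
    (b := t * (2 * Real.pi) ^ α) (by
      have := (Nat.cast_nonneg (Module.finrank ℝ (EuclideanSpace ℝ (Fin d)) - 1) : (0 : ℝ) ≤ _)
      linarith) h0 (by positivity)
  refine h.congr_fun (fun y hy => ?_) measurableSet_Ioi
  have hy' : (0 : ℝ) < y := hy
  simp only [smul_eq_mul, Real.rpow_natCast]
  rw [Real.mul_rpow (by positivity) hy'.le]
  ring_nf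

lemma isUnimodalSymbol_stable_euclidean (hd : 1 ≤ d) (h0 : 0 < α) (h2 : α < 2) {t : ℝ}
    (ht : 0 < t) : IsUnimodalSymbol (fun ξ : EuclideanSpace ℝ (Fin d) =>
      Real.exp (-t * (2 * Real.pi * ‖ξ‖) ^ α)) 1 := by
  have := nontrivial_euclideanSpace_fin hd
  exact isUnimodalSymbol_stable ht h0 h2 (integrable_exp_neg_mul_norm_rpow hd h0 ht)

lemma stableKernel_eq_ofReal (hd : 1 ≤ d) (h0 : 0 < α) (h2 : α < 2) {t : ℝ} (ht : 0 < t)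
    (z : EuclideanSpace ℝ (Fin d)) : stableKernel d α t z = (stableDensity d α t z : ℂ) :=
  Complex.ext rfl ((isUnimodalSymbol_stable_euclidean hd h0 h2 ht).im_eq_zero z)

lemma stableDensity_nonneg (hd : 1 ≤ d) (h0 : 0 < α) (h2 : α < 2) {t : ℝ} (ht : 0 < t)
    (z : EuclideanSpace ℝ (Fin d)) : 0 ≤ stableDensity d α t z :=
  (isUnimodalSymbol_stable_euclidean hd h0 h2 ht).re_nonneg z

lemma stableDensity_anti (hd : 1 ≤ d) (h0 : 0 < α) (h2 : α < 2) {t : ℝ} (ht : 0 < t)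
    {z w : EuclideanSpace ℝ (Fin d)} (h : ‖z‖ ≤ ‖w‖) :
    stableDensity d α t w ≤ stableDensity d α t z :=
  (isUnimodalSymbol_stable_euclidean hd h0 h2 ht).re_anti z w h

lemma continuous_stableKernel (hd : 1 ≤ d) (h0 : 0 < α) {t : ℝ} (ht : 0 < t) :
    Continuous (stableKernel d α t) :=
  continuous_fourierInv_ofReal (integrable_exp_neg_mul_norm_rpow hd h0 ht)

lemma continuous_stableDensity (hd : 1 ≤ d) (h0 : 0 < α) {t : ℝ} (ht : 0 < t) :
    Continuous (stableDensity d α t) :=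
  Complex.continuous_re.comp (continuous_stableKernel hd h0 ht)

lemma integrable_stableDensity (hd : 1 ≤ d) (h0 : 0 < α) (h2 : α < 2) {t : ℝ} (ht : 0 < t) :
    Integrable (stableDensity d α t) := by
  refine ⟨(continuous_stableDensity hd h0 ht).aestronglyMeasurable, ?_⟩
  rw [hasFiniteIntegral_iff_ofReal (Eventually.of_forall (stableDensity_nonneg hd h0 h2 ht))]
  exact (isUnimodalSymbol_stable_euclidean hd h0 h2 ht).lintegral_le.trans_lt ENNReal.ofReal_lt_top

lemma integrable_stableKernel (hd : 1 ≤ d) (h0 : 0 < α) (h2 : α < 2) {t : ℝ} (ht : 0 < t) :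
    Integrable (stableKernel d α t) :=
  (integrable_stableDensity hd h0 h2 ht).ofReal.congr
    (Eventually.of_forall fun z => (stableKernel_eq_ofReal hd h0 h2 ht z).symm)

/-- Fourier inversion requires the kernel to be integrable; this is where positivity and the mass
bound enter. -/
lemma fourier_stableKernel (hd : 1 ≤ d) (h0 : 0 < α) (h2 : α < 2) {t : ℝ} (ht : 0 < t) :
    𝓕 (stableKernel d α t) = fun ξ : EuclideanSpace ℝ (Fin d) =>
      ((Real.exp (-t * (2 * Real.pi * ‖ξ‖) ^ α) : ℝ) : ℂ) := by
  refine Continuous.fourier_fourierInv_eq ?_ (integrable_exp_neg_mul_norm_rpow hd h0 ht).ofReal ?_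
  · refine Complex.continuous_ofReal.comp (Real.continuous_exp.comp (continuous_const.mul ?_))
    exact (continuous_const.mul continuous_norm).rpow_const fun _ => Or.inr h0.le
  · have h := (integrable_stableKernel hd h0 h2 ht).comp_neg
    refine h.congr (Eventually.of_forall fun z => ?_)
    simp only [stableKernel, Real.fourierInv_eq_fourier_neg, neg_neg]

/-- The value of the Fourier transform at the origin; it turns the mass bound into an equality. -/
lemma integral_stableDensity (hd : 1 ≤ d) (h0 : 0 < α) (h2 : α < 2) {t : ℝ} (ht : 0 < t) :
    ∫ z, stableDensity d α t z = 1 := by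
  have h := congrFun (fourier_stableKernel hd h0 h2 ht) 0
  simp only [Real.fourier_eq, inner_zero_right, neg_zero, AddChar.map_zero_eq_one, one_smul,
    norm_zero, mul_zero, Real.zero_rpow h0.ne', Real.exp_zero,
    stableKernel_eq_ofReal hd h0 h2 ht] at h
  rw [integral_complex_ofReal] at h
  exact_mod_cast h

lemma stableDensity_le (hd : 1 ≤ d) (h0 : 0 < α) (h2 : α < 2) {t : ℝ} (ht : 0 < t)
    (z : EuclideanSpace ℝ (Fin d)) : stableDensity d α t z ≤ stableDensity d α t 0 :=
  stableDensity_anti hd h0 h2 ht (by simp)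

/-- A radially nonincreasing density of mass one decays at least like `|z|⁻ᵈ`. -/
lemma stableDensity_mul_volume_ball_le (hd : 1 ≤ d) (h0 : 0 < α) (h2 : α < 2) {t : ℝ} (ht : 0 < t)
    (z : EuclideanSpace ℝ (Fin d)) :
    stableDensity d α t z * (‖z‖ ^ d *
      volume.real (Metric.ball (0 : EuclideanSpace ℝ (Fin d)) 1)) ≤ 1 := by
  have := nontrivial_euclideanSpace_fin hd
  have hv : volume.real (Metric.ball (0 : EuclideanSpace ℝ (Fin d)) ‖z‖) =
      ‖z‖ ^ d * volume.real (Metric.ball (0 : EuclideanSpace ℝ (Fin d)) 1) := by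
    simp only [Measure.real, Measure.addHaar_ball (volume : Measure (EuclideanSpace ℝ (Fin d)))
      0 (norm_nonneg z), finrank_euclideanSpace_fin, ENNReal.toReal_mul]
    rw [ENNReal.toReal_ofReal (by positivity)]
  rw [← hv, mul_comm, ← smul_eq_mul, ← setIntegral_const, ← integral_stableDensity hd h0 h2 ht]
  refine (setIntegral_mono_on (integrableOn_const measure_ball_lt_top.ne)
    (integrable_stableDensity hd h0 h2 ht).integrableOn measurableSet_ball fun w hw => ?_).trans
    (setIntegral_le_integral (integrable_stableDensity hd h0 h2 ht)
      (Eventually.of_forall (stableDensity_nonneg hd h0 h2 ht)))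
  exact stableDensity_anti hd h0 h2 ht (by simpa using (mem_ball_zero_iff.1 hw).le)

/-- Substituting `r v` for the frequency variable absorbs `r^α` into `|v|^α`. Every time is thereby
reduced to time one. -/
lemma stableDensity_rpow {r : ℝ} (hr : 0 < r)
    (z : EuclideanSpace ℝ (Fin d)) :
    stableDensity d α (r ^ α) z = (r ^ d)⁻¹ * stableDensity d α 1 (r⁻¹ • z) := by
  have h : stableKernel d α (r ^ α) z = (r ^ d)⁻¹ • stableKernel d α 1 (r⁻¹ • z) := by
    simp only [stableKernel, Real.fourierInv_eq]
    have := Measure.integral_comp_smul_of_nonneg (volume : Measure (EuclideanSpace ℝ (Fin d)))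
      (fun v => Real.fourierChar (inner ℝ v (r⁻¹ • z)) •
        ((Real.exp (-1 * (2 * Real.pi * ‖v‖) ^ α) : ℝ) : ℂ)) r (hR := hr.le)
    rw [finrank_euclideanSpace_fin] at this
    rw [← this]
    congr with v
    have hpi := Real.pi_pos
    rw [inner_smul_left, inner_smul_right, norm_smul, Real.norm_of_nonneg hr.le,
      show 2 * Real.pi * (r * ‖v‖) = r * (2 * Real.pi * ‖v‖) by ring,
      Real.mul_rpow hr.le (by positivity)]
    simp [hr.ne']
  rw [stableDensity, h, Complex.smul_re, smul_eq_mul, stableDensity]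

lemma stableDensity_eq_scale (h0 : 0 < α) {s : ℝ} (hs : 0 < s)
    (z : EuclideanSpace ℝ (Fin d)) :
    stableDensity d α s z =
      ((s ^ α⁻¹) ^ d)⁻¹ * stableDensity d α 1 ((s ^ α⁻¹)⁻¹ • z) := by
  rw [← stableDensity_rpow (Real.rpow_pos_of_pos hs _), ← Real.rpow_mul hs.le,
    inv_mul_cancel₀ h0.ne', Real.rpow_one]

/-- The semigroup property of the kernels. -/
lemma integral_stableKernel_mul_stableKernel (hd : 1 ≤ d) (h0 : 0 < α) (h2 : α < 2) {s t : ℝ}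
    (hs : 0 < s) (ht : 0 < t) (z : EuclideanSpace ℝ (Fin d)) :
    ∫ y, stableKernel d α s y * stableKernel d α t (z - y) = stableKernel d α (s + t) z := by
  set k := convolution (stableKernel d α s) (stableKernel d α t) (ContinuousLinearMap.mul ℂ ℂ)
    volume with hk
  have hks := integrable_stableKernel hd h0 h2 hs
  have hkt := integrable_stableKernel hd h0 h2 ht
  -- Continuity makes the Fourier inversion below valid at every point rather than almost
  -- everywhere.
  have hkc : Continuous k := by
    refine BddAbove.continuous_convolution_right_of_integrable _ ?_ hks
      (continuous_stableKernel hd h0 ht)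
    refine ⟨stableDensity d α t 0, ?_⟩
    rintro _ ⟨w, rfl⟩
    simp only [stableKernel_eq_ofReal hd h0 h2 ht, Complex.norm_real,
      Real.norm_of_nonneg (stableDensity_nonneg hd h0 h2 ht w)]
    exact stableDensity_le hd h0 h2 ht w
  have hki : Integrable k := hks.integrable_convolution _ hkt
  have hF : 𝓕 k = fun ξ : EuclideanSpace ℝ (Fin d) =>
      ((Real.exp (-(s + t) * (2 * Real.pi * ‖ξ‖) ^ α) : ℝ) : ℂ) := by
    ext ξ
    rw [hk, Real.fourier_mul_convolution_eq hks hkt, fourier_stableKernel hd h0 h2 hs,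
      fourier_stableKernel hd h0 h2 ht, ← Complex.ofReal_mul, ← Real.exp_add]
    ring_nf
  have := congrFun (hkc.fourierInv_fourier_eq hki (by
    rw [hF]; exact (integrable_exp_neg_mul_norm_rpow hd h0 (add_pos hs ht)).ofReal)) z
  rw [hF] at this
  exact this.symm

lemma integral_stableDensity_mul_stableDensity (hd : 1 ≤ d) (h0 : 0 < α) (h2 : α < 2) {s t : ℝ}
    (hs : 0 < s) (ht : 0 < t) (z : EuclideanSpace ℝ (Fin d)) :
    ∫ y, stableDensity d α s y * stableDensity d α t (z - y) = stableDensity d α (s + t) z := by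
  have h := integral_stableKernel_mul_stableKernel hd h0 h2 hs ht z
  simp only [stableKernel_eq_ofReal hd h0 h2 hs, stableKernel_eq_ofReal hd h0 h2 ht,
    stableKernel_eq_ofReal hd h0 h2 (add_pos hs ht), ← Complex.ofReal_mul] at h
  rw [integral_complex_ofReal] at h
  exact_mod_cast h

/-- Change of variables in the integral against the kernel. -/
lemma integral_stableDensity_smul (h0 : 0 < α) {s : ℝ} (hs : 0 < s)
    (C : EuclideanSpace ℝ (Fin d) → ℂ) :
    ∫ z, stableDensity d α s z • C z = ∫ w, stableDensity d α 1 w • C (s ^ α⁻¹ • w) := by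
  have hr : 0 < s ^ α⁻¹ := Real.rpow_pos_of_pos hs _
  have := Measure.integral_comp_smul_of_nonneg (volume : Measure (EuclideanSpace ℝ (Fin d)))
      (fun v => stableDensity d α s v • C v) (s ^ α⁻¹) (hR := hr.le)
  rw [finrank_euclideanSpace_fin] at this
  rw [← inv_smul_smul₀ (inv_ne_zero (pow_ne_zero d hr.ne'))
    (∫ z, stableDensity d α s z • C z), ← this, ← integral_smul]
  congr with w
  rw [stableDensity_eq_scale h0 hs, inv_inv, smul_smul, ← mul_assoc,
    mul_inv_cancel₀ (pow_ne_zero d hr.ne'), one_mul, inv_smul_smul₀ hr.ne']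

end Kernel

/-! ### Young's inequality and uniform continuity of convolutions. -/

section Young

variable {V : Type*} [NormedAddCommGroup V] [InnerProductSpace ℝ V] [FiniteDimensional ℝ V]
  [MeasurableSpace V] [BorelSpace V]

lemma aestronglyMeasurable_comp_const_sub {E : Type*} [NormedAddCommGroup E] {K : V → E}
    (hK : AEStronglyMeasurable K volume) (x : V) :
    AEStronglyMeasurable (fun y => K (x - y)) volume :=
  hK.comp_measurePreserving (Measure.measurePreserving_sub_left volume x)

lemma eLpNorm_comp_const_sub {E : Type*} [NormedAddCommGroup E] {K : V → E}
    (hK : AEStronglyMeasurable K volume) (q : ℝ≥0∞) (x : V) :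
    eLpNorm (fun y => K (x - y)) q volume = eLpNorm K q volume :=
  eLpNorm_comp_measurePreserving hK (Measure.measurePreserving_sub_left volume x)

lemma memLp_comp_const_sub {E : Type*} [NormedAddCommGroup E] {K : V → E} {q : ℝ≥0∞}
    (hK : MemLp K q volume) (x : V) : MemLp (fun y => K (x - y)) q volume :=
  hK.comp_measurePreserving (Measure.measurePreserving_sub_left volume x)

/-- Hölder's inequality for two functions. -/
lemma lintegral_enorm_mul_enorm_le {p q : ℝ≥0∞} (hpq : p⁻¹ + q⁻¹ = 1) {h K : V → ℂ}
    (hh : AEStronglyMeasurable h volume) (hK : AEStronglyMeasurable K volume) :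
    ∫⁻ y, ‖h y‖ₑ * ‖K y‖ₑ ≤ eLpNorm h p volume * eLpNorm K q volume := by
  have : ENNReal.HolderTriple p q 1 := ⟨by rw [hpq, inv_one]⟩
  have := eLpNorm_smul_le_mul_eLpNorm (p := p) (q := q) (r := 1) hK hh
  rw [eLpNorm_one_eq_lintegral_enorm] at this
  simpa [enorm_mul] using this

/-- Young's convolution inequality, qualitative form with finite exponents. -/
lemma lintegral_lconvolution_rpow_lt_top {p q s : ℝ} (hp : 1 ≤ p) (hq : 1 ≤ q) (hs : 1 ≤ s)
    (hpqs : p⁻¹ + q⁻¹ = 1 + s⁻¹) {F k : V → ℝ≥0∞} (hF : AEMeasurable F) (hk : AEMeasurable k)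
    (hFp : ∫⁻ y, F y ^ p < ⊤) (hkq : ∫⁻ y, k y ^ q < ⊤) :
    ∫⁻ x, (∫⁻ y, F y * k (x - y)) ^ s < ⊤ := by
  have hp0 : 0 < p := by linarith
  have hq0 : 0 < q := by linarith
  have hs0 : 0 < s := by linarith
  have hp1 : p⁻¹ ≤ 1 := inv_le_one_of_one_le₀ hp
  have hq1 : q⁻¹ ≤ 1 := inv_le_one_of_one_le₀ hq
  -- Hölder with three weights of sum one, applied to `F k = (F^p k^q)^a (k^q)^b (F^p)^c`. After
  -- raising to the power `s`, only the first factor depends on `x`, and Tonelli integrates it.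
  set a := s⁻¹ with ha
  set b := q⁻¹ - s⁻¹ with hb
  set c := p⁻¹ - s⁻¹ with hc
  have ha0 : 0 ≤ a := by positivity
  have hb0 : 0 ≤ b := by linarith
  have hc0 : 0 ≤ c := by linarith
  have hksub : ∀ x, AEMeasurable (fun y => k (x - y)) := fun x =>
    hk.comp_quasiMeasurePreserving
      (Measure.measurePreserving_sub_left volume x).quasiMeasurePreserving
  have hksub' : ∀ x, ∫⁻ y, k (x - y) ^ q = ∫⁻ y, k y ^ q := fun x =>
    lintegral_sub_left_eq_self (fun y => k y ^ q) x
  have key : ∀ x, (∫⁻ y, F y * k (x - y)) ^ s ≤ (∫⁻ y, F y ^ p * k (x - y) ^ q) *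
      ((∫⁻ y, k y ^ q) ^ (b * s) * (∫⁻ y, F y ^ p) ^ (c * s)) := by
    intro x
    have h := ENNReal.lintegral_prod_norm_pow_le (μ := (volume : Measure V))
      (Finset.univ : Finset (Fin 3))
      (f := ![fun y => F y ^ p * k (x - y) ^ q, fun y => k (x - y) ^ q, fun y => F y ^ p])
      (p := ![a, b, c]) (by
        intro i _
        have h1 := hF.pow_const p
        have h2 := (hksub x).pow_const q
        fin_cases i
        · exact h1.mul h2
        · exact h2
        · exact h1)
      (by simp [Fin.sum_univ_three]; linarith)
      (by intro i _; fin_cases i <;> simp [ha0, hb0, hc0])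
    simp only [Fin.prod_univ_three, Matrix.cons_val_zero, Matrix.cons_val_one, Matrix.cons_val,
      hksub'] at h
    have e : ∀ y, (F y ^ p * k (x - y) ^ q) ^ a * (k (x - y) ^ q) ^ b * (F y ^ p) ^ c =
        F y * k (x - y) := by
      intro y
      rw [ENNReal.mul_rpow_of_nonneg _ _ ha0]
      have e1 : (F y ^ p) ^ a * (F y ^ p) ^ c = F y := by
        rw [← ENNReal.rpow_add_of_nonneg _ _ ha0 hc0, ← ENNReal.rpow_mul,
          show p * (a + c) = 1 by rw [hc, ha]; field_simp; ring, ENNReal.rpow_one]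
      have e2 : (k (x - y) ^ q) ^ a * (k (x - y) ^ q) ^ b = k (x - y) := by
        rw [← ENNReal.rpow_add_of_nonneg _ _ ha0 hb0, ← ENNReal.rpow_mul,
          show q * (a + b) = 1 by rw [hb, ha]; field_simp; ring, ENNReal.rpow_one]
      calc _ = ((F y ^ p) ^ a * (F y ^ p) ^ c) * ((k (x - y) ^ q) ^ a * (k (x - y) ^ q) ^ b) := by
            ring
        _ = _ := by rw [e1, e2]
    simp only [e] at h
    calc _ ≤ ((∫⁻ y, F y ^ p * k (x - y) ^ q) ^ a * (∫⁻ y, k y ^ q) ^ b *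
          (∫⁻ y, F y ^ p) ^ c) ^ s := ENNReal.rpow_le_rpow h hs0.le
      _ = _ := by
        rw [ENNReal.mul_rpow_of_nonneg _ _ hs0.le, ENNReal.mul_rpow_of_nonneg _ _ hs0.le,
          ← ENNReal.rpow_mul, ← ENNReal.rpow_mul, ← ENNReal.rpow_mul, ha,
          inv_mul_cancel₀ hs0.ne', ENNReal.rpow_one, mul_assoc]
  have hconst : (∫⁻ y, k y ^ q) ^ (b * s) * (∫⁻ y, F y ^ p) ^ (c * s) < ⊤ :=
    ENNReal.mul_lt_top (ENNReal.rpow_lt_top_of_nonneg (by positivity) hkq.ne)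
      (ENNReal.rpow_lt_top_of_nonneg (by positivity) hFp.ne)
  refine (lintegral_mono key).trans_lt ?_
  rw [lintegral_mul_const' _ _ hconst.ne]
  refine ENNReal.mul_lt_top ?_ hconst
  have hm : AEMeasurable (Function.uncurry fun x y => F y ^ p * k (x - y) ^ q)
      ((volume : Measure V).prod volume) := by
    refine AEMeasurable.mul ((hF.pow_const p).comp_snd) ?_
    exact (hk.pow_const q).comp_quasiMeasurePreserving
      (quasiMeasurePreserving_sub_of_right_invariant volume volume)
  rw [lintegral_lintegral_swap hm]
  have : ∀ y, ∫⁻ x, F y ^ p * k (x - y) ^ q = F y ^ p * ∫⁻ x, k x ^ q := by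
    intro y
    rw [lintegral_const_mul'']
    · rw [lintegral_sub_right_eq_self (fun x => k x ^ q) y]
    · exact (hk.pow_const q).comp_quasiMeasurePreserving
        (measurePreserving_sub_right volume y).quasiMeasurePreserving
  simp only [this]
  rw [lintegral_mul_const' _ _ hkq.ne]
  exact ENNReal.mul_lt_top hFp hkq

lemma enorm_convolution_mul_le (h K : V → ℂ) (x : V) :
    ‖convolution h K (ContinuousLinearMap.mul ℂ ℂ) volume x‖ₑ ≤ ∫⁻ y, ‖h y‖ₑ * ‖K (x - y)‖ₑ := by
  refine (enorm_integral_le_lintegral_enorm _).trans (le_of_eq ?_)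
  simp [enorm_mul]

lemma aestronglyMeasurable_convolution_mul {h K : V → ℂ} (hh : AEStronglyMeasurable h volume)
    (hK : AEStronglyMeasurable K volume) :
    AEStronglyMeasurable (convolution h K (ContinuousLinearMap.mul ℂ ℂ) volume) volume :=
  (hh.convolution_integrand (ContinuousLinearMap.mul ℂ ℂ) hK).integral_prod_right'

lemma enorm_convolution_mul_le_holder {p q : ℝ≥0∞} (hpq : p⁻¹ + q⁻¹ = 1) {h K : V → ℂ}
    (hh : AEStronglyMeasurable h volume) (hK : AEStronglyMeasurable K volume) (x : V) :
    ‖convolution h K (ContinuousLinearMap.mul ℂ ℂ) volume x‖ₑ ≤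
      eLpNorm h p volume * eLpNorm K q volume := by
  refine (enorm_convolution_mul_le h K x).trans ?_
  rw [← eLpNorm_comp_const_sub hK q x]
  exact lintegral_enorm_mul_enorm_le hpq hh (aestronglyMeasurable_comp_const_sub hK x)

/-- Young's convolution inequality, qualitative form. -/
theorem MeasureTheory.MemLp.convolution_mul {p q s : ℝ≥0∞} (hp : 1 ≤ p) (hq : 1 ≤ q) (hs : 1 ≤ s)
    (hpqs : p⁻¹ + q⁻¹ = 1 + s⁻¹) {h K : V → ℂ} (hh : MemLp h p volume) (hK : MemLp K q volume) :
    MemLp (convolution h K (ContinuousLinearMap.mul ℂ ℂ) volume) s volume := by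
  have hmeas := aestronglyMeasurable_convolution_mul hh.1 hK.1
  rcases eq_or_ne s ⊤ with rfl | hs'
  · rw [ENNReal.inv_top, add_zero] at hpqs
    have hb := enorm_convolution_mul_le_holder hpqs hh.1 hK.1
    refine ⟨hmeas, ?_⟩
    rw [eLpNorm_exponent_top]
    exact (eLpNormEssSup_le_of_ae_enorm_bound (Eventually.of_forall hb)).trans_lt
      (ENNReal.mul_lt_top hh.2 hK.2)
  · have hs0 : s⁻¹ ≠ 0 := ENNReal.inv_ne_zero.2 hs'
    have hp1 : p⁻¹ ≤ 1 := ENNReal.inv_le_one.2 hp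
    have hq1 : q⁻¹ ≤ 1 := ENNReal.inv_le_one.2 hq
    have hp' : p ≠ ⊤ := by
      rintro rfl
      rw [ENNReal.inv_top, zero_add] at hpqs
      exact (hpqs ▸ hq1).not_gt (ENNReal.lt_add_right ENNReal.one_ne_top hs0)
    have hq' : q ≠ ⊤ := by
      rintro rfl
      rw [ENNReal.inv_top, add_zero] at hpqs
      exact (hpqs ▸ hp1).not_gt (ENNReal.lt_add_right ENNReal.one_ne_top hs0)
    have hpz : p ≠ 0 := (zero_lt_one.trans_le hp).ne'
    have hqz : q ≠ 0 := (zero_lt_one.trans_le hq).ne'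
    have hsz : s ≠ 0 := (zero_lt_one.trans_le hs).ne'
    have hreal : p.toReal⁻¹ + q.toReal⁻¹ = 1 + s.toReal⁻¹ := by
      have := congrArg ENNReal.toReal hpqs
      rwa [ENNReal.toReal_add (by simpa) (by simpa), ENNReal.toReal_add (by simp) (by simpa),
        ENNReal.toReal_inv, ENNReal.toReal_inv, ENNReal.toReal_inv, ENNReal.toReal_one] at this
    have h1 : ∀ {u : ℝ≥0∞}, 1 ≤ u → u ≠ ⊤ → 1 ≤ u.toReal := fun h1 h2 => by
      simpa using ENNReal.toReal_mono h2 h1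
    have hfin := lintegral_lconvolution_rpow_lt_top (h1 hp hp') (h1 hq hq') (h1 hs hs') hreal
      hh.1.enorm hK.1.enorm
      ((eLpNorm_lt_top_iff_lintegral_rpow_enorm_lt_top hpz hp').1 hh.2)
      ((eLpNorm_lt_top_iff_lintegral_rpow_enorm_lt_top hqz hq').1 hK.2)
    refine ⟨hmeas, (eLpNorm_lt_top_iff_lintegral_rpow_enorm_lt_top hsz hs').2 ?_⟩
    refine (lintegral_mono fun x => ?_).trans_lt hfin
    exact ENNReal.rpow_le_rpow (enorm_convolution_mul_le h K x) ENNReal.toReal_nonneg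

/-- The convolution of an `L^p` function with an integrable function exists almost everywhere. -/
lemma MeasureTheory.MemLp.ae_convolutionExistsAt {p : ℝ≥0∞} (hp : 1 ≤ p) {h K : V → ℂ}
    (hh : MemLp h p volume) (hK : Integrable K volume) :
    ∀ᵐ x, ConvolutionExistsAt h K x (ContinuousLinearMap.mul ℂ ℂ) volume := by
  have hm : ∀ x, AEStronglyMeasurable
      (fun y => ContinuousLinearMap.mul ℂ ℂ (h y) (K (x - y))) volume := fun x =>
    hh.1.mul (aestronglyMeasurable_comp_const_sub hK.1 x)
  have hmm : AEMeasurable (fun x => ∫⁻ y, ‖h y‖ₑ * ‖K (x - y)‖ₑ) := by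
    have := (hh.1.convolution_integrand (ContinuousLinearMap.mul ℂ ℂ) hK.1).enorm
    simpa [enorm_mul] using this.lintegral_prod_right'
  have hfin : ∀ᵐ x, ∫⁻ y, ‖h y‖ₑ * ‖K (x - y)‖ₑ < ⊤ := by
    -- For `p = ∞` Hölder gives a finite bound at every point; otherwise Young with exponents `p, 1,
    -- p` gives finiteness almost everywhere.
    rcases eq_or_ne p ⊤ with rfl | hp'
    · refine Eventually.of_forall fun x => ?_
      have := lintegral_enorm_mul_enorm_le (p := ⊤) (q := 1) (by simp) hh.1
        (aestronglyMeasurable_comp_const_sub hK.1 x)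
      rw [eLpNorm_comp_const_sub hK.1] at this
      exact this.trans_lt (ENNReal.mul_lt_top hh.2 (memLp_one_iff_integrable.2 hK).2)
    · have h1 : 1 ≤ p.toReal := by simpa using ENNReal.toReal_mono hp' hp
      have := lintegral_lconvolution_rpow_lt_top h1 le_rfl h1 (by rw [inv_one, add_comm])
        hh.1.enorm hK.1.enorm
        ((eLpNorm_lt_top_iff_lintegral_rpow_enorm_lt_top (zero_lt_one.trans_le hp).ne' hp').1 hh.2)
        (by simpa [HasFiniteIntegral] using hK.2)
      filter_upwards [ae_lt_top' (hmm.pow_const _) this.ne] with x hx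
      by_contra hcon
      rw [not_lt_top_iff] at hcon
      rw [hcon, ENNReal.top_rpow_of_pos (by linarith)] at hx
      exact lt_irrefl _ hx
  filter_upwards [hfin] with x hx
  refine ⟨hm x, ?_⟩
  simpa [HasFiniteIntegral, enorm_mul] using hx

/-- Translations are continuous in `L^p`, `p < ∞`. -/
lemma MeasureTheory.MemLp.tendsto_eLpNorm_translate_sub {p : ℝ≥0∞} (hp : 1 ≤ p) (hp' : p ≠ ⊤)
    {h : V → ℂ} (hh : MemLp h p volume) :
    Tendsto (fun e => eLpNorm (fun y => h (e + y) - h y) p volume) (𝓝 0) (𝓝 0) := by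
  have : Fact (1 ≤ p) := ⟨hp⟩
  have : Fact (p ≠ ⊤) := ⟨hp'⟩
  -- The translation group acts continuously on `L^p` for finite `p`.
  have hc : Continuous fun e : V => DomAddAct.mk e +ᵥ hh.toLp h := by
    have h1 : Continuous (fun e : V => (DomAddAct.mk e : Vᵈᵃᵃ)) := DomAddAct.continuous_mk
    exact h1.vadd continuous_const
  have ht := (hc.edist continuous_const (g := fun _ => hh.toLp h)).tendsto 0
  have e : ∀ e : V, edist (DomAddAct.mk e +ᵥ hh.toLp h) (hh.toLp h) =
      eLpNorm (fun y => h (e + y) - h y) p volume := by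
    intro e
    rw [DomAddAct.mk_vadd_toLp, Lp.edist_toLp_toLp]
    rfl
  simp only [e] at ht
  simpa using ht

/-- Translating `h * K` by `e` changes it by the convolution of `h (e + ·) - h` with `K`. Hölder
bounds this uniformly in the point by an `L^p` norm that vanishes as `e → 0`, since `p < ∞`. -/
lemma uniformContinuous_convolution_mul_of_left {p q : ℝ≥0∞} (hp : 1 ≤ p)
    (hpq : p⁻¹ + q⁻¹ = 1) {h K : V → ℂ} (hh : MemLp h p volume) (hK : MemLp K q volume)
    (hp' : p ≠ ⊤) : UniformContinuous (convolution h K (ContinuousLinearMap.mul ℂ ℂ) volume) := by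
  have hT := ENNReal.Tendsto.mul_const (hh.tendsto_eLpNorm_translate_sub hp hp')
    (b := eLpNorm K q volume) (Or.inr hK.2.ne)
  rw [zero_mul] at hT
  have hdiff : ∀ x e : V, edist (convolution h K (ContinuousLinearMap.mul ℂ ℂ) volume (e + x))
      (convolution h K (ContinuousLinearMap.mul ℂ ℂ) volume x) ≤
      eLpNorm (fun y => h (e + y) - h y) p volume * eLpNorm K q volume := by
    intro x e
    have : ENNReal.HolderConjugate p q := ⟨by rw [hpq, inv_one]⟩
    have hte : MemLp (fun y => h (e + y)) p volume :=
      hh.comp_measurePreserving (measurePreserving_add_left volume e)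
    have hKx := memLp_comp_const_sub hK x
    have h1 : convolution h K (ContinuousLinearMap.mul ℂ ℂ) volume (e + x) =
        convolution (fun y => h (e + y)) K (ContinuousLinearMap.mul ℂ ℂ) volume x := by
      simp only [convolution, ContinuousLinearMap.mul_apply']
      rw [← integral_add_left_eq_self _ e]
      simp only [add_sub_add_left_eq_sub]
    have h2 : convolution h K (ContinuousLinearMap.mul ℂ ℂ) volume (e + x) -
        convolution h K (ContinuousLinearMap.mul ℂ ℂ) volume x =
        convolution (fun y => h (e + y) - h y) K (ContinuousLinearMap.mul ℂ ℂ) volume x := by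
      rw [h1]
      simp only [convolution, ContinuousLinearMap.mul_apply']
      have := integral_sub (hte.integrable_mul hKx) (hh.integrable_mul hKx)
      simp only [Pi.mul_apply] at this
      rw [← this]
      simp only [sub_mul]
    rw [edist_eq_enorm_sub, h2]
    exact enorm_convolution_mul_le_holder hpq (hte.1.sub hh.1) hK.1 x
  rw [EMetric.uniformContinuous_iff]
  intro ε hε
  have hε2 : 0 < min (ε / 2) 1 := lt_min (ENNReal.half_pos hε.ne') zero_lt_one
  obtain ⟨δ, hδ, H⟩ := EMetric.mem_nhds_iff.1 (ENNReal.tendsto_nhds_zero.1 hT _ hε2)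
  refine ⟨δ, hδ, fun {a b} hab => ?_⟩
  have h3 := hdiff b (a - b)
  rw [sub_add_cancel] at h3
  have h4 : a - b ∈ Metric.eball (0 : V) δ := by
    rwa [Metric.mem_eball, edist_eq_enorm_sub, sub_zero, ← edist_eq_enorm_sub]
  refine (h3.trans (H h4)).trans_lt ?_
  rcases eq_or_ne ε ⊤ with rfl | hε'
  · exact (min_le_right _ _).trans_lt ENNReal.one_lt_top
  · exact (min_le_left _ _).trans_lt (ENNReal.half_lt_self hε.ne' hε')

/-- The convolution of functions with conjugate exponents is uniformly continuous. -/
theorem uniformContinuous_convolution_mul {p q : ℝ≥0∞} (hp : 1 ≤ p) (hq : 1 ≤ q)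
    (hpq : p⁻¹ + q⁻¹ = 1) {h K : V → ℂ} (hh : MemLp h p volume) (hK : MemLp K q volume) :
    UniformContinuous (convolution h K (ContinuousLinearMap.mul ℂ ℂ) volume) := by
  by_cases hp' : p = ⊤
  · have hq' : q ≠ ⊤ := by
      rintro rfl
      simp [hp'] at hpq
    have : convolution h K (ContinuousLinearMap.mul ℂ ℂ) volume =
        convolution K h (ContinuousLinearMap.mul ℂ ℂ) volume := by
      rw [← convolution_flip]
      simp
    rw [this]
    exact uniformContinuous_convolution_mul_of_left hq (by rw [add_comm, hpq]) hK hh hq'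
  · exact uniformContinuous_convolution_mul_of_left hp hpq hh hK hp'

end Young

/-! ### Integrability of the truncated potential kernel. -/

/-- The kernel `∫₀¹ p_s ds`. -/
noncomputable def truncatedPotential (d : ℕ) (α : ℝ) (z : EuclideanSpace ℝ (Fin d)) : ℝ :=
  ∫ s in Set.Ioc (0 : ℝ) 1, stableDensity d α s z

section Potential

variable {d : ℕ} {α : ℝ}

/-- Scaling expresses `p_s` through the continuous function `p₁`, which makes joint measurability in
`(s, z)` visible. -/
lemma aestronglyMeasurable_stableDensity_prod (hd : 1 ≤ d) (h0 : 0 < α) :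
    AEStronglyMeasurable (fun x : ℝ × EuclideanSpace ℝ (Fin d) => stableDensity d α x.1 x.2)
      ((volume.restrict (Set.Ioc (0 : ℝ) 1)).prod volume) := by
  have hm : Measurable (fun x : ℝ × EuclideanSpace ℝ (Fin d) =>
      ((x.1 ^ α⁻¹) ^ d)⁻¹ * stableDensity d α 1 ((x.1 ^ α⁻¹)⁻¹ • x.2)) := by
    have h1 : Measurable (fun x : ℝ × EuclideanSpace ℝ (Fin d) => x.1 ^ α⁻¹) :=
      measurable_fst.pow_const _
    exact (h1.pow_const d).inv.mul
      ((continuous_stableDensity hd h0 one_pos).measurable.comp (h1.inv.smul measurable_snd))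
  refine hm.aestronglyMeasurable.congr ?_
  have hae : ∀ᵐ x ∂((volume.restrict (Set.Ioc (0 : ℝ) 1)).prod
      (volume : Measure (EuclideanSpace ℝ (Fin d)))), x.1 ∈ Set.Ioc (0 : ℝ) 1 :=
    Measure.quasiMeasurePreserving_fst.ae (ae_restrict_mem measurableSet_Ioc)
  filter_upwards [hae] with x hx
  exact (stableDensity_eq_scale h0 hx.1 x.2).symm

lemma integrable_stableDensity_prod (hd : 1 ≤ d) (h0 : 0 < α) (h2 : α < 2) :
    Integrable (fun x : ℝ × EuclideanSpace ℝ (Fin d) => stableDensity d α x.1 x.2)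
      ((volume.restrict (Set.Ioc (0 : ℝ) 1)).prod volume) := by
  have hm := aestronglyMeasurable_stableDensity_prod hd h0
  refine (integrable_prod_iff hm).2 ⟨?_, ?_⟩
  · filter_upwards [ae_restrict_mem measurableSet_Ioc] with s hs
    exact integrable_stableDensity hd h0 h2 hs.1
  · refine (integrable_const (1 : ℝ)).congr ?_
    filter_upwards [ae_restrict_mem measurableSet_Ioc] with s hs
    rw [← integral_stableDensity hd h0 h2 hs.1]
    refine integral_congr_ae (Eventually.of_forall fun z => ?_)
    exact (Real.norm_of_nonneg (stableDensity_nonneg hd h0 h2 hs.1 z)).symm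

lemma integrable_truncatedPotential (hd : 1 ≤ d) (h0 : 0 < α) (h2 : α < 2) :
    Integrable (truncatedPotential d α) :=
  (integrable_stableDensity_prod hd h0 h2).integral_prod_right

lemma truncatedPotential_nonneg (hd : 1 ≤ d) (h0 : 0 < α) (h2 : α < 2)
    (z : EuclideanSpace ℝ (Fin d)) : 0 ≤ truncatedPotential d α z :=
  setIntegral_nonneg measurableSet_Ioc fun _ hs => stableDensity_nonneg hd h0 h2 hs.1 z

/-- The geometric mean, with weights `θ` and `1 - θ`, of `p_s(z) ≤ A s^(-d/α)` and `p_s(z) ≤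
(ω|z|^d)⁻¹`. The integral in `s` converges because `θ d/α < 1`. The case `θ = 0` bounds the kernel
away from the origin, and `θ = 1`, available for `α > d`, bounds it off the origin by a constant. -/
lemma exists_truncatedPotential_le (hd : 1 ≤ d) (h0 : 0 < α) (h2 : α < 2) {θ : ℝ} (hθ0 : 0 ≤ θ)
    (hθ1 : θ ≤ 1) (hθ : θ < α / d) :
    ∃ C : ℝ, 0 ≤ C ∧ ∀ z : EuclideanSpace ℝ (Fin d), z ≠ 0 →
      truncatedPotential d α z ≤ C * ‖z‖ ^ (-((1 - θ) * d)) := by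
  have hd0 : (0 : ℝ) < d := by exact_mod_cast hd
  set A := stableDensity d α 1 0 with hA
  have hA0 : 0 ≤ A := stableDensity_nonneg hd h0 h2 one_pos 0
  set ω := volume.real (Metric.ball (0 : EuclideanSpace ℝ (Fin d)) 1) with hω
  have hω0 : 0 < ω := ENNReal.toReal_pos (Metric.measure_ball_pos _ _ one_pos).ne'
    measure_ball_lt_top.ne
  have hexp : -1 < -(d / α * θ) := by
    have : θ * d < α := (lt_div_iff₀ hd0).1 hθ
    have : d / α * θ < 1 := by rw [div_mul_eq_mul_div, div_lt_one h0]; linarith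
    linarith
  have hint : IntegrableOn (fun s : ℝ => s ^ (-(d / α * θ))) (Set.Ioc 0 1) :=
    (intervalIntegral.intervalIntegrable_rpow' hexp).1
  refine ⟨A ^ θ * ω ^ (-(1 - θ)) * ∫ s in Set.Ioc (0 : ℝ) 1, s ^ (-(d / α * θ)), ?_,
    fun z hz => ?_⟩
  · have : 0 ≤ ∫ s in Set.Ioc (0 : ℝ) 1, s ^ (-(d / α * θ)) :=
      setIntegral_nonneg measurableSet_Ioc fun s hs => Real.rpow_nonneg hs.1.le _
    positivity
  have hz0 : 0 < ‖z‖ := norm_pos_iff.2 hz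
  have hpt : ∀ s ∈ Set.Ioc (0 : ℝ) 1, stableDensity d α s z ≤
      A ^ θ * ω ^ (-(1 - θ)) * ‖z‖ ^ (-((1 - θ) * d)) * s ^ (-(d / α * θ)) := by
    intro s hs
    have hp := stableDensity_nonneg hd h0 h2 hs.1 z
    have b1 : stableDensity d α s z ≤ s ^ (-(d / α)) * A := by
      refine (stableDensity_le hd h0 h2 hs.1 z).trans (le_of_eq ?_)
      rw [stableDensity_eq_scale h0 hs.1, smul_zero, ← Real.rpow_natCast, ← Real.rpow_mul hs.1.le,
        ← Real.rpow_neg hs.1.le, inv_mul_eq_div]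
    have b2 : stableDensity d α s z ≤ (‖z‖ ^ (d : ℝ) * ω)⁻¹ := by
      have := stableDensity_mul_volume_ball_le hd h0 h2 hs.1 z
      rw [← Real.rpow_natCast] at this
      rw [← one_div]
      exact (le_div_iff₀ (by positivity)).2 this
    calc stableDensity d α s z
        = stableDensity d α s z ^ θ * stableDensity d α s z ^ (1 - θ) := by
          rw [← Real.rpow_add_of_nonneg hp hθ0 (by linarith), add_sub_cancel, Real.rpow_one]
      _ ≤ (s ^ (-(d / α)) * A) ^ θ * ((‖z‖ ^ (d : ℝ) * ω)⁻¹) ^ (1 - θ) := by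
          have := Real.rpow_nonneg hs.1.le (-(d / α))
          have h1θ : 0 ≤ 1 - θ := by linarith
          gcongr
      _ = _ := by
          rw [Real.mul_rpow (Real.rpow_nonneg hs.1.le _) hA0, ← Real.rpow_mul hs.1.le,
            Real.inv_rpow (by positivity), Real.mul_rpow (by positivity) hω0.le,
            ← Real.rpow_mul hz0.le, mul_inv, ← Real.rpow_neg hω0.le, ← Real.rpow_neg hz0.le]
          rw [show -(d / α) * θ = -(d / α * θ) by ring, show -(d * (1 - θ)) = -((1 - θ) * d) by ring]
          ring
  calc truncatedPotential d α z
      ≤ ∫ s in Set.Ioc (0 : ℝ) 1,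
          A ^ θ * ω ^ (-(1 - θ)) * ‖z‖ ^ (-((1 - θ) * d)) * s ^ (-(d / α * θ)) := by
        refine integral_mono_of_nonneg ?_ (hint.const_mul _) ?_
        · filter_upwards [ae_restrict_mem measurableSet_Ioc] with s hs
          exact stableDensity_nonneg hd h0 h2 hs.1 z
        · filter_upwards [ae_restrict_mem measurableSet_Ioc] with s hs
          exact hpt s hs
    _ = _ := by
        rw [integral_const_mul]
        ring

/-- The part of `∫₀¹ p_s ds` near the origin, as a complex function. -/
noncomputable def innerPotential (d : ℕ) (α ε : ℝ) : EuclideanSpace ℝ (Fin d) → ℂ :=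
  (Metric.ball 0 ε).indicator fun z => (truncatedPotential d α z : ℂ)

/-- The part of `∫₀¹ p_s ds` away from the origin, as a complex function. -/
noncomputable def outerPotential (d : ℕ) (α ε : ℝ) : EuclideanSpace ℝ (Fin d) → ℂ :=
  (Metric.ball 0 ε)ᶜ.indicator fun z => (truncatedPotential d α z : ℂ)

lemma innerPotential_add_outerPotential (ε : ℝ) (z : EuclideanSpace ℝ (Fin d)) :
    innerPotential d α ε z + outerPotential d α ε z = truncatedPotential d α z :=
  congrFun (Set.indicator_self_add_compl (Metric.ball 0 ε)
    fun z => (truncatedPotential d α z : ℂ)) z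

lemma integrable_innerPotential (hd : 1 ≤ d) (h0 : 0 < α) (h2 : α < 2) (ε : ℝ) :
    Integrable (innerPotential d α ε) :=
  (integrable_truncatedPotential hd h0 h2).ofReal.indicator measurableSet_ball

lemma integrable_outerPotential (hd : 1 ≤ d) (h0 : 0 < α) (h2 : α < 2) (ε : ℝ) :
    Integrable (outerPotential d α ε) :=
  (integrable_truncatedPotential hd h0 h2).ofReal.indicator measurableSet_ball.compl

/-- For finite `q`, `|K|^q ≤ |C|^(q-1) |K|`. -/
lemma memLp_of_integrable_of_bound {X : Type*} [MeasurableSpace X] {μ : Measure X} {K : X → ℂ}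
    (hK : Integrable K μ) {C : ℝ} (hC : ∀ᵐ x ∂μ, ‖K x‖ ≤ C) {q : ℝ≥0∞} (hq : 1 ≤ q) :
    MemLp K q μ := by
  rcases eq_or_ne q ⊤ with rfl | hq'
  · exact memLp_top_of_bound hK.1 C hC
  · have h1 : 1 ≤ q.toReal := by simpa using ENNReal.toReal_mono hq' hq
    refine (integrable_norm_rpow_iff hK.1 (zero_lt_one.trans_le hq).ne' hq').1 ?_
    refine (hK.norm.const_mul (|C| ^ (q.toReal - 1))).mono
      (hK.1.norm.aemeasurable.pow_const _).aestronglyMeasurable ?_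
    filter_upwards [hC] with x hx
    rw [Real.norm_of_nonneg (by positivity), Real.norm_of_nonneg (by positivity)]
    rcases eq_or_ne ‖K x‖ 0 with h | h
    · rw [h, mul_zero, Real.zero_rpow (by linarith)]
    · have e : ‖K x‖ ^ q.toReal = ‖K x‖ ^ (q.toReal - 1) * ‖K x‖ := by
        rw [← Real.rpow_add_one h, sub_add_cancel]
      rw [e]
      gcongr
      exact hx.trans (le_abs_self C)

lemma memLp_outerPotential (hd : 1 ≤ d) (h0 : 0 < α) (h2 : α < 2) {ε : ℝ} (hε : 0 < ε)
    {q : ℝ≥0∞} (hq : 1 ≤ q) : MemLp (outerPotential d α ε) q volume := by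
  have hd0 : (0 : ℝ) < d := by exact_mod_cast hd
  obtain ⟨C, hC0, hC⟩ := exists_truncatedPotential_le hd h0 h2 le_rfl zero_le_one
    (div_pos h0 hd0)
  refine memLp_of_integrable_of_bound (integrable_outerPotential hd h0 h2 ε)
    (C := C * ε ^ (-((1 - (0 : ℝ)) * d))) (Eventually.of_forall fun z => ?_) hq
  by_cases hz : z ∈ (Metric.ball (0 : EuclideanSpace ℝ (Fin d)) ε)ᶜ
  · have hzε : ε ≤ ‖z‖ := by simpa using hz
    rw [outerPotential, Set.indicator_of_mem hz, Complex.norm_real,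
      Real.norm_of_nonneg (truncatedPotential_nonneg hd h0 h2 z)]
    refine (hC z (norm_pos_iff.1 (hε.trans_le hzε))).trans ?_
    gcongr ?_ * ?_
    exact Real.rpow_le_rpow_of_nonpos hε hzε (by rw [sub_zero, one_mul]; linarith)
  · rw [outerPotential, Set.indicator_of_notMem hz, norm_zero]
    positivity

/-- In polar coordinates the integrand is a multiple of `y^(d-1-aq)`, integrable near zero exactly
when `aq < d`. -/
lemma memLp_indicator_ball_norm_rpow (hd : 1 ≤ d) {a : ℝ} {q : ℝ≥0∞} (hq : 1 ≤ q) (hq' : q ≠ ⊤)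
    (haq : a * q.toReal < d) (C ε : ℝ) :
    MemLp ((Metric.ball (0 : EuclideanSpace ℝ (Fin d)) ε).indicator fun z => C * ‖z‖ ^ (-a))
      q volume := by
  have := nontrivial_euclideanSpace_fin hd
  have hmeas : AEStronglyMeasurable (fun z : EuclideanSpace ℝ (Fin d) => C * ‖z‖ ^ (-a)) volume :=
    (measurable_norm.pow_const _).const_mul C |>.aestronglyMeasurable
  have hq1 : 1 ≤ q.toReal := by simpa using ENNReal.toReal_mono hq' hq
  rw [memLp_indicator_iff_restrict measurableSet_ball,
    ← integrable_norm_rpow_iff hmeas.restrict (zero_lt_one.trans_le hq).ne' hq']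
  refine (integrableOn_fun_norm_addHaar (E := EuclideanSpace ℝ (Fin d)) volume (r := ε)
    (f := fun y : ℝ => ‖C * y ^ (-a)‖ ^ q.toReal)).2 ?_
  have hi : IntegrableOn (fun y : ℝ => |C| ^ q.toReal * y ^ ((d : ℝ) - 1 - a * q.toReal))
      (Set.Ioo 0 ε) := by
    rcases le_or_gt ε 0 with hε | hε
    · rw [Set.Ioo_eq_empty (not_lt.2 hε)]; exact integrableOn_empty
    · refine Integrable.const_mul ?_ _
      exact (intervalIntegral.integrableOn_Ioo_rpow_iff hε).2 (by linarith)
  refine hi.congr_fun (fun y hy => ?_) measurableSet_Ioo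
  have hy0 : 0 < y := hy.1
  simp only [finrank_euclideanSpace_fin, smul_eq_mul, norm_mul, Real.norm_eq_abs]
  rw [abs_of_nonneg (Real.rpow_nonneg hy0.le _), Real.mul_rpow (abs_nonneg _)
    (Real.rpow_nonneg hy0.le _), ← Real.rpow_mul hy0.le, ← Real.rpow_natCast, Nat.cast_sub hd,
    mul_left_comm, ← Real.rpow_add hy0]
  push_cast
  ring_nf

lemma memLp_innerPotential (hd : 1 ≤ d) (h0 : 0 < α) (h2 : α < 2) (ε : ℝ)
    {q : ℝ≥0∞} (hq : 1 ≤ q) (hqα : 1 - α / d < (q⁻¹).toReal) :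
    MemLp (innerPotential d α ε) q volume := by
  have := nontrivial_euclideanSpace_fin hd
  have hd0 : (0 : ℝ) < d := by exact_mod_cast hd
  have hne : ∀ᵐ z : EuclideanSpace ℝ (Fin d), z ≠ 0 := by simp [ae_iff, measure_singleton]
  have hmeas := (integrable_innerPotential hd h0 h2 (d := d) ε).1
  rcases eq_or_ne q ⊤ with rfl | hq'
  · obtain ⟨C, hC0, hC⟩ := exists_truncatedPotential_le hd h0 h2 zero_le_one le_rfl
      (by simpa using hqα)
    refine memLp_top_of_bound hmeas C ?_
    filter_upwards [hne] with z hz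
    refine (norm_indicator_le_norm_self _ _).trans ?_
    rw [Complex.norm_real, Real.norm_of_nonneg (truncatedPotential_nonneg hd h0 h2 z)]
    simpa using hC z hz
  · have hq1 : 1 ≤ q.toReal := by simpa using ENNReal.toReal_mono hq' hq
    rw [ENNReal.toReal_inv] at hqα
    have hinv1 : q.toReal⁻¹ ≤ 1 := inv_le_one_of_one_le₀ hq1
    have hinv0 : 0 < q.toReal⁻¹ := by positivity
    -- `θ < α/d` is what the pointwise bound needs, and `θ > 1 - 1/q` makes `|z|^(-(1-θ)d)` locally
    -- `q`-integrable. Both are possible exactly because `1/q > 1 - α/d`.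
    obtain ⟨θ, hθl, hθu⟩ := exists_between (show 1 - q.toReal⁻¹ < min 1 (α / d) from
      lt_min (by linarith) (by linarith))
    obtain ⟨C, hC0, hC⟩ := exists_truncatedPotential_le hd h0 h2 (by linarith)
      (hθu.le.trans (min_le_left _ _)) (hθu.trans_le (min_le_right _ _))
    refine (memLp_indicator_ball_norm_rpow hd hq hq' (a := (1 - θ) * d) ?_ C ε).mono hmeas ?_
    · have h3 : (1 - θ) * q.toReal < 1 := by
        have := mul_lt_mul_of_pos_right (show 1 - θ < q.toReal⁻¹ by linarith)
          (show 0 < q.toReal by linarith)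
        rwa [inv_mul_cancel₀ (by positivity)] at this
      nlinarith
    · filter_upwards [hne] with z hz
      rw [innerPotential, norm_indicator_eq_indicator_norm, norm_indicator_eq_indicator_norm]
      refine Set.indicator_le_indicator ?_
      rw [Complex.norm_real, Real.norm_of_nonneg (truncatedPotential_nonneg hd h0 h2 z)]
      exact (hC z hz).trans (le_abs_self _)

end Potential

/-! ### The integrated semigroup equation for bounded continuous functions. -/

section Semigroup

variable {d : ℕ} {α : ℝ}

lemma integrable_stableDensity_smul (hd : 1 ≤ d) (h0 : 0 < α) (h2 : α < 2) {t : ℝ} (ht : 0 < t)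
    {C : EuclideanSpace ℝ (Fin d) → ℂ} (hC : Continuous C) {B : ℝ} (hB : ∀ z, ‖C z‖ ≤ B) :
    Integrable fun z => stableDensity d α t z • C z :=
  (integrable_stableDensity hd h0 h2 ht).smul_bdd B hC.aestronglyMeasurable
    (Eventually.of_forall hB)

lemma norm_integral_stableDensity_smul_le (hd : 1 ≤ d) (h0 : 0 < α) (h2 : α < 2) {t : ℝ}
    (ht : 0 < t) {C : EuclideanSpace ℝ (Fin d) → ℂ} {B : ℝ} (hB : ∀ z, ‖C z‖ ≤ B) :
    ‖∫ z, stableDensity d α t z • C z‖ ≤ B := by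
  refine (norm_integral_le_of_norm_le ((integrable_stableDensity hd h0 h2 ht).mul_const B)
    (Eventually.of_forall fun w => ?_)).trans
    (le_of_eq (by rw [integral_mul_const, integral_stableDensity hd h0 h2 ht, one_mul]))
  rw [norm_smul, Real.norm_of_nonneg (stableDensity_nonneg hd h0 h2 ht w)]
  exact mul_le_mul_of_nonneg_left (hB _) (stableDensity_nonneg hd h0 h2 ht w)

lemma integral_stableDensity_add_smul (hd : 1 ≤ d) (h0 : 0 < α) (h2 : α < 2) {s t : ℝ}
    (hs : 0 < s) (ht : 0 < t) {C : EuclideanSpace ℝ (Fin d) → ℂ} (hC : Continuous C) {B : ℝ}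
    (hB : ∀ z, ‖C z‖ ≤ B) :
    ∫ z, stableDensity d α (s + t) z • C z =
      ∫ y, stableDensity d α s y • ∫ z, stableDensity d α t z • C (y + z) := by
  have hint : Integrable (fun x : EuclideanSpace ℝ (Fin d) × EuclideanSpace ℝ (Fin d) =>
      (stableDensity d α s x.2 * stableDensity d α t (x.1 - x.2)) • C x.1)
      ((volume : Measure (EuclideanSpace ℝ (Fin d))).prod volume) := by
    have h := (integrable_stableDensity hd h0 h2 hs).convolution_integrand
      (ContinuousLinearMap.mul ℝ ℝ) (integrable_stableDensity hd h0 h2 ht)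
    exact h.smul_bdd B (hC.comp continuous_fst).aestronglyMeasurable
      (Eventually.of_forall fun x => hB _)
  calc ∫ z, stableDensity d α (s + t) z • C z
      = ∫ z, ∫ y, (stableDensity d α s y * stableDensity d α t (z - y)) • C z := by
        refine integral_congr_ae (Eventually.of_forall fun z => ?_)
        simp only
        rw [← integral_stableDensity_mul_stableDensity hd h0 h2 hs ht z, integral_smul_const]
    _ = ∫ y, ∫ z, (stableDensity d α s y * stableDensity d α t (z - y)) • C z :=
        integral_integral_swap hint
    _ = _ := by
        refine integral_congr_ae (Eventually.of_forall fun y => ?_)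
        simp only [mul_smul]
        rw [integral_smul, ← integral_add_left_eq_self _ y]
        simp only [add_sub_cancel_left]

/-- After rescaling, `s` occurs only inside the argument of `C`, so dominated convergence applies up
to and including `s = 0`. -/
lemma continuous_integral_stableDensity_scale (hd : 1 ≤ d) (h0 : 0 < α) (h2 : α < 2)
    {C : EuclideanSpace ℝ (Fin d) → ℂ} (hC : Continuous C) {B : ℝ} (hB : ∀ z, ‖C z‖ ≤ B) :
    Continuous fun s : ℝ => ∫ w, stableDensity d α 1 w • C (s ^ α⁻¹ • w) := by
  have hr : Continuous fun s : ℝ => s ^ α⁻¹ :=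
    Real.continuous_rpow_const (by positivity)
  refine continuous_of_dominated (bound := fun w => stableDensity d α 1 w * B) (fun s => ?_)
    (fun s => Eventually.of_forall fun w => ?_)
    ((integrable_stableDensity hd h0 h2 one_pos).mul_const B)
    (Eventually.of_forall fun w => ?_)
  · exact ((continuous_stableDensity hd h0 one_pos).smul
      (hC.comp (continuous_const_smul (s ^ α⁻¹)))).aestronglyMeasurable
  · rw [norm_smul, Real.norm_of_nonneg (stableDensity_nonneg hd h0 h2 one_pos w)]
    exact mul_le_mul_of_nonneg_left (hB _) (stableDensity_nonneg hd h0 h2 one_pos w)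
  · exact (hC.comp (hr.smul (continuous_const (y := w)))).const_smul (stableDensity d α 1 w)

/-- If `Γ` is the generator applied to `C` (uniformly), then `p₁ * C - C = ∫₀¹ p_s * Γ ds` at the
origin. -/
lemma integral_stableDensity_sub_eq (hd : 1 ≤ d) (h0 : 0 < α) (h2 : α < 2)
    {C Γ : EuclideanSpace ℝ (Fin d) → ℂ} (hC : Continuous C) (hΓ : Continuous Γ) {B : ℝ}
    (hCB : ∀ z, ‖C z‖ ≤ B) (hΓB : ∀ z, ‖Γ z‖ ≤ B) {η : ℝ → ℝ} (hη : Tendsto η (𝓝[>] 0) (𝓝 0))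
    (hCΓ : ∀ᶠ t in 𝓝[>] 0, ∀ y,
      ‖t⁻¹ • ((∫ z, stableDensity d α t z • C (y + z)) - C y) - Γ y‖ ≤ η t) :
    (∫ z, stableDensity d α 1 z • C z) - C 0 = ∫ z, truncatedPotential d α z • Γ z := by
  set u : ℝ → ℂ := fun s => ∫ w, stableDensity d α 1 w • C (s ^ α⁻¹ • w) with hu
  set v : ℝ → ℂ := fun s => ∫ w, stableDensity d α 1 w • Γ (s ^ α⁻¹ • w) with hv
  have huc : Continuous u := continuous_integral_stableDensity_scale hd h0 h2 hC hCB
  have hvc : Continuous v := continuous_integral_stableDensity_scale hd h0 h2 hΓ hΓB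
  have hu' : ∀ s, 0 < s → u s = ∫ z, stableDensity d α s z • C z := fun s hs =>
    (integral_stableDensity_smul h0 hs C).symm
  have hv' : ∀ s, 0 < s → v s = ∫ z, stableDensity d α s z • Γ z := fun s hs =>
    (integral_stableDensity_smul h0 hs Γ).symm
  have hu0 : u 0 = C 0 := by
    simp only [hu]
    rw [Real.zero_rpow (inv_ne_zero h0.ne')]
    simp only [zero_smul]
    rw [integral_smul_const, integral_stableDensity hd h0 h2 one_pos, one_smul]
  -- The hypothesis controls forward increments only, through `P_{s+t} C - P_s C = P_s (P_t C - C)`.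
  -- A right derivative suffices for the fundamental theorem of calculus, as `u` and `v` are
  -- continuous.
  have hderiv : ∀ s ∈ Set.Ioo (0 : ℝ) 1, HasDerivWithinAt u (v s) (Set.Ioi s) s := by
    intro s hs
    rw [hasDerivWithinAt_iff_tendsto_slope' (by simp)]
    have hmap : Tendsto (fun x => x - s) (𝓝[>] s) (𝓝[>] 0) := by
      refine tendsto_nhdsWithin_iff.2 ⟨?_, ?_⟩
      · have : Tendsto (fun x => x - s) (𝓝 s) (𝓝 (s - s)) := (continuous_id.sub continuous_const).tendsto s
        rw [sub_self] at this
        exact this.mono_left nhdsWithin_le_nhds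
      · filter_upwards [self_mem_nhdsWithin] with x hx
        exact sub_pos.2 (Set.mem_Ioi.1 hx)
    rw [tendsto_iff_norm_sub_tendsto_zero]
    refine squeeze_zero' (Eventually.of_forall fun _ => norm_nonneg _) ?_ (hη.comp hmap)
    filter_upwards [hmap.eventually hCΓ, self_mem_nhdsWithin] with x hx hxs
    set t := x - s with ht
    have ht0 : 0 < t := sub_pos.2 hxs
    have hxst : x = s + t := by rw [ht]; ring
    have hTc : Continuous fun y => ∫ z, stableDensity d α t z • C (y + z) := by
      refine continuous_of_dominated (bound := fun w => stableDensity d α t w * B) (fun s => ?_)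
        (fun s => Eventually.of_forall fun w => ?_)
        ((integrable_stableDensity hd h0 h2 ht0).mul_const B)
        (Eventually.of_forall fun w => ?_)
      · exact ((continuous_stableDensity hd h0 ht0).smul
          (hC.comp (continuous_const.add continuous_id))).aestronglyMeasurable
      · rw [norm_smul, Real.norm_of_nonneg (stableDensity_nonneg hd h0 h2 ht0 w)]
        exact mul_le_mul_of_nonneg_left (hCB _) (stableDensity_nonneg hd h0 h2 ht0 w)
      · exact (hC.comp (continuous_id.add (continuous_const (y := w)))).const_smul
          (stableDensity d α t w)
    have hTB : ∀ y, ‖∫ z, stableDensity d α t z • C (y + z)‖ ≤ B := fun y =>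
      norm_integral_stableDensity_smul_le hd h0 h2 ht0 fun z => hCB _
    have hi1 := integrable_stableDensity_smul hd h0 h2 hs.1 hTc hTB
    have hi2 := integrable_stableDensity_smul hd h0 h2 hs.1 hC hCB
    have hi3 := integrable_stableDensity_smul hd h0 h2 hs.1 hΓ hΓB
    have hsub := integral_sub ((hi1.sub hi2).smul t⁻¹) hi3
    simp only [Pi.smul_apply, Pi.sub_apply] at hsub
    -- The error at time `s` is an average, with respect to `p_s`, of the error at time zero, hence
    -- again at most `η t`.
    have e : slope u s x - v s = ∫ y, stableDensity d α s y •
        (t⁻¹ • ((∫ z, stableDensity d α t z • C (y + z)) - C y) - Γ y) := by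
      rw [slope_def_module, ← ht, hxst, hu' _ (add_pos hs.1 ht0), hu' _ hs.1, hv' _ hs.1,
        integral_stableDensity_add_smul hd h0 h2 hs.1 ht0 hC hCB, ← integral_sub hi1 hi2,
        ← integral_smul, ← hsub]
      refine integral_congr_ae (Eventually.of_forall fun y => ?_)
      simp only [smul_sub, smul_comm t⁻¹]
    rw [e]
    exact norm_integral_stableDensity_smul_le hd h0 h2 hs.1 hx
  have hftc := intervalIntegral.integral_eq_sub_of_hasDeriv_right_of_le zero_le_one
    huc.continuousOn hderiv (hvc.intervalIntegrable 0 1)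
  rw [hu0, hu' 1 one_pos, intervalIntegral.integral_of_le zero_le_one] at hftc
  rw [← hftc]
  have hswap : Integrable (Function.uncurry fun (s : ℝ) (z : EuclideanSpace ℝ (Fin d)) =>
      stableDensity d α s z • Γ z) ((volume.restrict (Set.Ioc (0 : ℝ) 1)).prod volume) :=
    (integrable_stableDensity_prod hd h0 h2).smul_bdd B
      (hΓ.comp continuous_snd).aestronglyMeasurable (Eventually.of_forall fun x => hΓB _)
  calc ∫ s in Set.Ioc (0 : ℝ) 1, v s
      = ∫ s in Set.Ioc (0 : ℝ) 1, ∫ z, stableDensity d α s z • Γ z :=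
        setIntegral_congr_fun measurableSet_Ioc fun s hs => hv' s hs.1
    _ = ∫ z, ∫ s in Set.Ioc (0 : ℝ) 1, stableDensity d α s z • Γ z := integral_integral_swap hswap
    _ = _ := by
        refine integral_congr_ae (Eventually.of_forall fun z => ?_)
        simp only
        rw [integral_smul_const, truncatedPotential]

end Semigroup

/-! ### Young exponents and pairing with test functions. -/

/-- The order `p ≤ s` makes `1 + 1/s - 1/p` at most one, and `p ≥ 1` keeps the truncated subtraction
exact. The real-valued form is what gets compared with `1 - α/d`. -/
lemma exists_young_exponent {p s : ℝ≥0∞} (hp : 1 ≤ p) (hps : p ≤ s) :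
    ∃ q : ℝ≥0∞, 1 ≤ q ∧ p⁻¹ + q⁻¹ = 1 + s⁻¹ ∧
      (q⁻¹).toReal = 1 + (s⁻¹).toReal - (p⁻¹).toReal := by
  have hp1 : p⁻¹ ≤ 1 := ENNReal.inv_le_one.2 hp
  have hs1 : s⁻¹ ≤ p⁻¹ := ENNReal.inv_le_inv.2 hps
  have hle : p⁻¹ ≤ 1 + s⁻¹ := hp1.trans le_self_add
  have hs' : s⁻¹ ≠ ⊤ := ne_top_of_le_ne_top ENNReal.one_ne_top (hs1.trans hp1)
  refine ⟨(1 + s⁻¹ - p⁻¹)⁻¹, ?_, ?_, ?_⟩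
  · rw [ENNReal.one_le_inv, tsub_le_iff_right]
    gcongr
  · rw [inv_inv, add_tsub_cancel_of_le hle]
  · rw [inv_inv, ENNReal.toReal_sub_of_le hle (by simp [hs']), ENNReal.toReal_add (by simp) hs',
      ENNReal.toReal_one]

section Pairing

variable {V : Type*} [NormedAddCommGroup V] [InnerProductSpace ℝ V] [FiniteDimensional ℝ V]
  [MeasurableSpace V] [BorelSpace V]

lemma eLpNorm_comp_const_add {ψ : V → ℂ} (hψ : AEStronglyMeasurable ψ volume) (q : ℝ≥0∞) (z : V) :
    eLpNorm (fun y => ψ (z + y)) q volume = eLpNorm ψ q volume :=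
  eLpNorm_comp_measurePreserving hψ (measurePreserving_add_left volume z)

lemma eLpNorm_comp_sub_const {h : V → ℂ} (hh : AEStronglyMeasurable h volume) (p : ℝ≥0∞) (z : V) :
    eLpNorm (fun y => h (y - z)) p volume = eLpNorm h p volume :=
  eLpNorm_comp_measurePreserving hh (measurePreserving_sub_right volume z)

/-- The correlation of `h` with a test function `ψ`. -/
noncomputable def correlation (h ψ : V → ℂ) (z : V) : ℂ := ∫ x, h x * ψ (z + x)

lemma memLp_comp_const_add {ψ : V → ℂ} {q : ℝ≥0∞} (hψ : MemLp ψ q volume) (z : V) :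
    MemLp (fun y => ψ (z + y)) q volume :=
  hψ.comp_measurePreserving (measurePreserving_add_left volume z)

lemma enorm_correlation_le {p q : ℝ≥0∞} (hpq : p⁻¹ + q⁻¹ = 1) {h ψ : V → ℂ}
    (hh : MemLp h p volume) (hψ : MemLp ψ q volume) (z : V) :
    ‖correlation h ψ z‖ₑ ≤ eLpNorm h p volume * eLpNorm ψ q volume := by
  refine (enorm_integral_le_lintegral_enorm _).trans ?_
  simp only [enorm_mul]
  refine (lintegral_enorm_mul_enorm_le hpq hh.1 (memLp_comp_const_add hψ z).1).trans (le_of_eq ?_)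
  rw [eLpNorm_comp_const_add hψ.1]

lemma norm_correlation_le {p q : ℝ≥0∞} (hpq : p⁻¹ + q⁻¹ = 1) {h ψ : V → ℂ}
    (hh : MemLp h p volume) (hψ : MemLp ψ q volume) (z : V) :
    ‖correlation h ψ z‖ ≤ (eLpNorm h p volume * eLpNorm ψ q volume).toReal := by
  rw [← toReal_enorm]
  exact ENNReal.toReal_mono (ENNReal.mul_lt_top hh.2 hψ.2).ne (enorm_correlation_le hpq hh hψ z)

/-- The correlation at `z` is the convolution of `h` with the reflection of `ψ`, evaluated at `-z`.
-/
lemma continuous_correlation {p q : ℝ≥0∞} (hp : 1 ≤ p) (hq : 1 ≤ q) (hpq : p⁻¹ + q⁻¹ = 1)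
    {h ψ : V → ℂ} (hh : MemLp h p volume) (hψ : MemLp ψ q volume) :
    Continuous (correlation h ψ) := by
  have hψ' : MemLp (fun y => ψ (-y)) q volume :=
    hψ.comp_measurePreserving (Measure.measurePreserving_neg volume)
  have hc := (uniformContinuous_convolution_mul hp hq hpq hh hψ').continuous.comp continuous_neg
  convert hc using 1
  ext z
  simp [correlation, convolution, add_comm]

/-- Pairing a convolution with a test function. -/
lemma integral_convolution_mul {p q : ℝ≥0∞} (hpq : p⁻¹ + q⁻¹ = 1)
    {h ψ : V → ℂ} (hh : MemLp h p volume) (hψ : MemLp ψ q volume) {κ : V → ℝ} (hκ : Integrable κ)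
    (w : V) :
    correlation (convolution h (fun z => (κ z : ℂ)) (ContinuousLinearMap.mul ℂ ℂ) volume) ψ w =
      ∫ z, κ z • correlation h ψ (w + z) := by
  have : ENNReal.HolderConjugate p q := ⟨by rw [hpq, inv_one]⟩
  have hsub : ∀ z, MemLp (fun y => h (y - z)) p volume := fun z =>
    hh.comp_measurePreserving (measurePreserving_sub_right volume z)
  have hψw := memLp_comp_const_add hψ w
  have hm : AEStronglyMeasurable (fun x : V × V => h (x.1 - x.2) * (κ x.2 : ℂ) * ψ (w + x.1))
      ((volume : Measure V).prod volume) := by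
    refine AEStronglyMeasurable.mul (AEStronglyMeasurable.mul ?_ ?_) ?_
    · exact hh.1.comp_quasiMeasurePreserving
        (quasiMeasurePreserving_sub_of_right_invariant volume volume)
    · exact hκ.ofReal.1.comp_snd
    · exact hψw.1.comp_fst
  set B := (eLpNorm h p volume * eLpNorm ψ q volume).toReal with hB
  -- A bound independent of the shift `z`; together with integrability of `κ` it justifies Fubini.
  have hHolder : ∀ z, ∫ y, ‖h (y - z)‖ * ‖ψ (w + y)‖ ≤ B := by
    intro z
    have e1 := lintegral_enorm_mul_enorm_le hpq (hsub z).1 hψw.1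
    rw [eLpNorm_comp_sub_const hh.1, eLpNorm_comp_const_add hψ.1] at e1
    rw [integral_eq_lintegral_of_nonneg_ae (f := fun y => ‖h (y - z)‖ * ‖ψ (w + y)‖)
      (Eventually.of_forall fun y => mul_nonneg (norm_nonneg _) (norm_nonneg _))
      ((hsub z).1.norm.mul hψw.1.norm)]
    refine ENNReal.toReal_mono (ENNReal.mul_lt_top hh.2 hψ.2).ne (le_trans (le_of_eq ?_) e1)
    simp only [ENNReal.ofReal_mul (norm_nonneg _), ofReal_norm]
  have hint : Integrable (fun x : V × V => h (x.1 - x.2) * (κ x.2 : ℂ) * ψ (w + x.1))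
      ((volume : Measure V).prod volume) := by
    refine (integrable_prod_iff' hm).2 ⟨Eventually.of_forall fun z => ?_, ?_⟩
    · have := ((hsub z).integrable_mul hψw).mul_const (κ z : ℂ)
      refine this.congr (Eventually.of_forall fun y => ?_)
      simp only [Pi.mul_apply]
      ring
    · refine (hκ.norm.mul_const B).mono hm.norm.prod_swap.integral_prod_right'
        (Eventually.of_forall fun z => ?_)
      rw [Real.norm_of_nonneg (integral_nonneg fun y => norm_nonneg _)]
      simp only [norm_mul, Complex.norm_real, mul_right_comm _ ‖κ z‖]
      rw [integral_mul_const, mul_comm]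
      refine (mul_le_mul_of_nonneg_left (hHolder z) (norm_nonneg _)).trans ?_
      rw [norm_norm]
      exact mul_le_mul_of_nonneg_left (le_abs_self B) (norm_nonneg _)
  calc _ = ∫ y, ∫ z, h (y - z) * (κ z : ℂ) * ψ (w + y) := by
        refine integral_congr_ae (Eventually.of_forall fun y => ?_)
        simp only
        rw [convolution_eq_swap, integral_mul_const]
        simp
    _ = ∫ z, ∫ y, h (y - z) * (κ z : ℂ) * ψ (w + y) := integral_integral_swap hint
    _ = _ := by
        refine integral_congr_ae (Eventually.of_forall fun z => ?_)
        simp only [correlation]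
        rw [← integral_smul, ← integral_add_right_eq_self _ z]
        refine integral_congr_ae (Eventually.of_forall fun y => ?_)
        simp only [add_sub_cancel_right, Complex.real_smul]
        rw [show w + (y + z) = w + z + y by abel]
        ring

end Pairing

/-! ### The representation of `f` and its local consequences. -/

section Representation

variable {d : ℕ} {α : ℝ} {p : ℝ≥0∞} {f g : EuclideanSpace ℝ (Fin d) → ℂ}

lemma memLp_stableKernel (hd : 1 ≤ d) (h0 : 0 < α) (h2 : α < 2) {t : ℝ} (ht : 0 < t) {q : ℝ≥0∞}
    (hq : 1 ≤ q) : MemLp (stableKernel d α t) q volume := by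
  refine memLp_of_integrable_of_bound (integrable_stableKernel hd h0 h2 ht)
    (C := stableDensity d α t 0) (Eventually.of_forall fun z => ?_) hq
  rw [stableKernel_eq_ofReal hd h0 h2 ht, Complex.norm_real,
    Real.norm_of_nonneg (stableDensity_nonneg hd h0 h2 ht z)]
  exact stableDensity_le hd h0 h2 ht z

lemma stableSemigroup_eq (hd : 1 ≤ d) (h0 : 0 < α) (h2 : α < 2) {t : ℝ} (ht : 0 < t) :
    stableSemigroup α t f = convolution f (fun z => (stableDensity d α t z : ℂ))
      (ContinuousLinearMap.mul ℂ ℂ) volume := by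
  rw [stableSemigroup]
  congr 1
  ext z
  exact stableKernel_eq_ofReal hd h0 h2 ht z

lemma memLp_stableSemigroup (hd : 1 ≤ d) (h0 : 0 < α) (h2 : α < 2) {t : ℝ} (ht : 0 < t)
    (hp : 1 ≤ p) {s : ℝ≥0∞} (hps : p ≤ s) (hf : MemLp f p volume) :
    MemLp (stableSemigroup α t f) s volume := by
  obtain ⟨q, hq, hpq, -⟩ := exists_young_exponent hp hps
  exact hf.convolution_mul hp hq (hp.trans hps) hpq (memLp_stableKernel hd h0 h2 ht hq)

/-- `f = P₁ f - (∫₀¹ p_s ds) * L f`. -/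
theorem HasFracLaplacian.ae_eq_sub (hd : 1 ≤ d) (h0 : 0 < α) (h2 : α < 2) (hp : 1 ≤ p)
    (hfg : HasFracLaplacian α p f g) :
    ∀ᵐ y, f y = stableSemigroup α 1 f y - convolution g (fun z => (truncatedPotential d α z : ℂ))
      (ContinuousLinearMap.mul ℂ ℂ) volume y := by
  obtain ⟨q, hq, hpq, -⟩ := exists_young_exponent hp (le_top : p ≤ ⊤)
  rw [ENNReal.inv_top, add_zero] at hpq
  have hf := hfg.memLp
  have hg := hfg.memLp_image
  have hPf : ∀ t : ℝ, 0 < t → MemLp (stableSemigroup α t f) p volume := fun t ht =>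
    memLp_stableSemigroup hd h0 h2 ht hp le_rfl hf
  have hVg : MemLp (convolution g (fun z => (truncatedPotential d α z : ℂ))
      (ContinuousLinearMap.mul ℂ ℂ) volume) p volume :=
    hg.convolution_mul hp le_rfl hp (by rw [inv_one, add_comm])
      (memLp_one_iff_integrable.2 (integrable_truncatedPotential hd h0 h2).ofReal)
  refine ae_eq_of_integral_contDiff_smul_eq (hf.locallyIntegrable hp)
    (((hPf 1 one_pos).sub hVg).locallyIntegrable hp) fun φ hφ hφs => ?_
  set ψ : EuclideanSpace ℝ (Fin d) → ℂ := fun y => (φ y : ℂ) with hψdef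
  have hψ : MemLp ψ q volume :=
    (hφ.continuous.memLp_of_hasCompactSupport hφs).ofReal
  have : ENNReal.HolderConjugate p q := ⟨by rw [hpq, inv_one]⟩
  have hzero : ∀ u : EuclideanSpace ℝ (Fin d) → ℂ, ∫ y, φ y • u y = correlation u ψ 0 := by
    intro u
    simp [correlation, hψdef, mul_comm]
  have hint : ∀ {u : EuclideanSpace ℝ (Fin d) → ℂ} (z), MemLp u p volume →
      Integrable fun x => u x * ψ (z + x) := fun z hu =>
    hu.integrable_mul (memLp_comp_const_add hψ z)
  have hsub : ∀ {u v : EuclideanSpace ℝ (Fin d) → ℂ} (z), MemLp u p volume → MemLp v p volume →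
      correlation (fun y => u y - v y) ψ z = correlation u ψ z - correlation v ψ z := by
    intro u v z hu hv
    simp only [correlation, sub_mul]
    exact integral_sub (hint z hu) (hint z hv)
  -- By Hölder, the `L^p` error of the difference quotient, times the norm of `ψ`, bounds the error
  -- of the correlations uniformly in the shift.
  have hη : Tendsto (fun t : ℝ => (eLpNorm (fun y => (stableSemigroup α t f y - f y) / (t : ℂ) - g y)
      p volume * eLpNorm ψ q volume).toReal) (𝓝[>] 0) (𝓝 0) := by
    have h := ENNReal.Tendsto.mul_const hfg.tendsto (b := eLpNorm ψ q volume) (Or.inr hψ.2.ne)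
    rw [zero_mul] at h
    exact (ENNReal.tendsto_toReal ENNReal.zero_ne_top).comp h
  have key := integral_stableDensity_sub_eq hd h0 h2
    (C := correlation f ψ) (Γ := correlation g ψ)
    (continuous_correlation hp hq hpq hf hψ) (continuous_correlation hp hq hpq hg hψ)
    (B := max (eLpNorm f p volume * eLpNorm ψ q volume).toReal
      (eLpNorm g p volume * eLpNorm ψ q volume).toReal)
    (fun z => (norm_correlation_le hpq hf hψ z).trans (le_max_left _ _))
    (fun z => (norm_correlation_le hpq hg hψ z).trans (le_max_right _ _)) hη (by
      filter_upwards [self_mem_nhdsWithin] with t ht y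
      have ht0 : (0 : ℝ) < t := ht
      have hD0 : MemLp (fun y => stableSemigroup α t f y - f y) p volume := (hPf t ht0).sub hf
      have hD : MemLp (fun y => (stableSemigroup α t f y - f y) / (t : ℂ)) p volume := by
        simpa [div_eq_mul_inv] using hD0.mul_const ((t : ℂ)⁻¹)
      have hDg : MemLp (fun y => (stableSemigroup α t f y - f y) / (t : ℂ) - g y) p volume :=
        hD.sub hg
      refine le_trans (le_of_eq ?_) (norm_correlation_le hpq hDg hψ y)
      rw [hsub y hD hg]
      have e : correlation (fun y => (stableSemigroup α t f y - f y) / (t : ℂ)) ψ y =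
          t⁻¹ • correlation (fun y => stableSemigroup α t f y - f y) ψ y := by
        simp only [correlation, ← integral_smul, Complex.real_smul]
        congr with x
        push_cast
        ring
      rw [e, hsub y (hPf t ht0) hf, stableSemigroup_eq hd h0 h2 ht0,
        integral_convolution_mul hpq hf hψ (integrable_stableDensity hd h0 h2 ht0)])
  rw [hzero, hzero, hsub 0 (hPf 1 one_pos) hVg, stableSemigroup_eq hd h0 h2 one_pos,
    integral_convolution_mul hpq hf hψ (integrable_stableDensity hd h0 h2 one_pos),
    integral_convolution_mul hpq hg hψ (integrable_truncatedPotential hd h0 h2)]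
  simp only [zero_add]
  rw [← key]
  ring

/-- The representation of `f` near `x` that only uses the values of `L f` in a ball. -/
noncomputable def localRepresentative (α ε : ℝ) (x : EuclideanSpace ℝ (Fin d)) (R : ℝ≥0∞)
    (f g : EuclideanSpace ℝ (Fin d) → ℂ) (y : EuclideanSpace ℝ (Fin d)) : ℂ :=
  stableSemigroup α 1 f y
    - convolution g (outerPotential d α ε) (ContinuousLinearMap.mul ℂ ℂ) volume y
    - convolution ((Metric.eball x R).indicator g) (innerPotential d α ε)
        (ContinuousLinearMap.mul ℂ ℂ) volume y

/-- For `y` in the smaller ball the inner kernel reaches only points within `ε` of `y`, and these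
lie in the larger ball since `r + ε ≤ R`. Cutting `g` off there changes nothing. The potential may
be split wherever both convolutions exist, which is almost everywhere. -/
theorem HasFracLaplacian.ae_eq_localRepresentative (hd : 1 ≤ d) (h0 : 0 < α) (h2 : α < 2)
    (hp : 1 ≤ p) (hfg : HasFracLaplacian α p f g) {ε : ℝ} {x : EuclideanSpace ℝ (Fin d)}
    {r R : ℝ≥0∞} (hrR : r + ENNReal.ofReal ε ≤ R) :
    ∀ᵐ y, y ∈ Metric.eball x r → localRepresentative α ε x R f g y = f y := by
  filter_upwards [hfg.ae_eq_sub hd h0 h2 hp,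
    hfg.memLp_image.ae_convolutionExistsAt hp (integrable_innerPotential hd h0 h2 ε),
    hfg.memLp_image.ae_convolutionExistsAt hp (integrable_outerPotential hd h0 h2 ε)]
    with y hy h1 h3 hyr
  have e : (fun z : EuclideanSpace ℝ (Fin d) => (truncatedPotential d α z : ℂ)) =
      innerPotential d α ε + outerPotential d α ε := by
    ext z
    exact (innerPotential_add_outerPotential ε z).symm
  have e2 : convolution ((Metric.eball x R).indicator g) (innerPotential d α ε)
      (ContinuousLinearMap.mul ℂ ℂ) volume y =
      convolution g (innerPotential d α ε) (ContinuousLinearMap.mul ℂ ℂ) volume y := by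
    refine integral_congr_ae (Eventually.of_forall fun z => ?_)
    simp only [ContinuousLinearMap.mul_apply']
    by_cases hz : z ∈ Metric.eball x R
    · rw [Set.indicator_of_mem hz]
    · have : y - z ∉ Metric.ball (0 : EuclideanSpace ℝ (Fin d)) ε := by
        intro hmem
        apply hz
        rw [mem_ball_zero_iff, ← dist_eq_norm] at hmem
        have h4 : edist y z < ENNReal.ofReal ε := by
          rw [edist_dist]
          exact (ENNReal.ofReal_lt_ofReal_iff (dist_nonneg.trans_lt hmem)).2 hmem
        refine lt_of_lt_of_le ?_ hrR
        calc edist z x ≤ edist y x + edist y z := by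
              rw [add_comm, edist_comm y z]; exact edist_triangle z y x
          _ < r + ENNReal.ofReal ε := ENNReal.add_lt_add hyr h4
      rw [innerPotential, Set.indicator_of_notMem this, mul_zero, mul_zero]
  rw [hy, localRepresentative, e2, e, h1.distrib_add h3]
  ring

lemma exists_pos_add_ofReal_le {r R : ℝ≥0∞} (h : (0 < r ∧ r < R ∧ R < ⊤) ∨ (r = ⊤ ∧ R = ⊤)) :
    ∃ ε : ℝ, 0 < ε ∧ r + ENNReal.ofReal ε ≤ R := by
  rcases h with ⟨-, hrR, hR⟩ | ⟨-, rfl⟩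
  · have hpos : 0 < R - r := tsub_pos_of_lt hrR
    have hfin : R - r ≠ ⊤ := ne_top_of_le_ne_top hR.ne tsub_le_self
    refine ⟨(R - r).toReal, ENNReal.toReal_pos hpos.ne' hfin, ?_⟩
    rw [ENNReal.ofReal_toReal hfin, add_tsub_cancel_of_le hrR.le]
  · exact ⟨1, one_pos, le_top⟩

/-- Each term of the local representative is a convolution with conjugate exponents. For the
exponent `q'` conjugate to `p'`, the condition `p' > d/α` says that `1/q' > 1 - α/d`, so the inner
kernel lies in `L^q'`. -/
theorem HasFracLaplacian.exists_uniformContinuousOn (hd : 1 ≤ d) (h0 : 0 < α) (h2 : α < 2)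
    (hp : 1 ≤ p) (hfg : HasFracLaplacian α p f g) {x : EuclideanSpace ℝ (Fin d)}
    {p' r R : ℝ≥0∞} (hpp' : p < p') (hrR : (0 < r ∧ r < R ∧ R < ⊤) ∨ (r = ⊤ ∧ R = ⊤))
    (hg : MemLp ((Metric.eball x R).indicator g) p' volume)
    (hp'α : ENNReal.ofReal ((d : ℝ) / α) < p') :
    ∃ f' : EuclideanSpace ℝ (Fin d) → ℂ,
      f' =ᵐ[volume] f ∧ UniformContinuousOn f' (Metric.eball x r) := by
  have hd0 : (0 : ℝ) < d := by exact_mod_cast hd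
  obtain ⟨ε, hε, hεR⟩ := exists_pos_add_ofReal_le hrR
  obtain ⟨q, hq, hpq, -⟩ := exists_young_exponent hp (le_top : p ≤ ⊤)
  obtain ⟨q', hq', hpq', hq'r⟩ := exists_young_exponent (hp.trans hpp'.le) (le_top : p' ≤ ⊤)
  rw [ENNReal.inv_top, add_zero] at hpq hpq'
  have hinv : (p'⁻¹).toReal < α / d := by
    have h3 : p'⁻¹ < ENNReal.ofReal (α / d) := by
      rw [← inv_div, ENNReal.ofReal_inv_of_pos (by positivity)]
      exact ENNReal.inv_lt_inv.2 hp'α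
    exact (ENNReal.toReal_lt_of_lt_ofReal h3)
  have hq'α : 1 - α / d < (q'⁻¹).toReal := by
    rw [hq'r, ENNReal.inv_top, ENNReal.toReal_zero]
    linarith
  have hU : UniformContinuous (localRepresentative α ε x R f g) :=
    ((uniformContinuous_convolution_mul hp hq hpq hfg.memLp
      (memLp_stableKernel hd h0 h2 one_pos hq)).sub
      (uniformContinuous_convolution_mul hp hq hpq hfg.memLp_image
        (memLp_outerPotential hd h0 h2 hε hq))).sub
      (uniformContinuous_convolution_mul (hp.trans hpp'.le) hq' hpq' hg
        (memLp_innerPotential hd h0 h2 ε hq' hq'α))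
  classical
  refine ⟨(Metric.eball x r).piecewise (localRepresentative α ε x R f g) f, ?_, ?_⟩
  · filter_upwards [hfg.ae_eq_localRepresentative hd h0 h2 hp hεR (x := x)] with y hy
    by_cases hyr : y ∈ Metric.eball x r
    · rw [Set.piecewise_eq_of_mem _ _ _ hyr, hy hyr]
    · rw [Set.piecewise_eq_of_notMem _ _ _ hyr]
  · exact hU.uniformContinuousOn.congr fun y hy => (Set.piecewise_eq_of_mem _ _ _ hy).symm

/-- Young's inequality from `L^p'` to `L^s'` needs a kernel in `L^q'` with `1/q' = 1 + 1/s' - 1/p'`;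
the hypothesis on `s'` says that this exceeds `1 - α/d`. The other terms map `L^p` to `L^s'` without
restriction, their kernels being in every `L^q`. -/
theorem HasFracLaplacian.memLp_indicator (hd : 1 ≤ d) (h0 : 0 < α) (h2 : α < 2)
    (hp : 1 ≤ p) (hfg : HasFracLaplacian α p f g) {x : EuclideanSpace ℝ (Fin d)}
    {p' s' r R : ℝ≥0∞} (hpp' : p < p') (hps : p' ≤ s')
    (hrR : (0 < r ∧ r < R ∧ R < ⊤) ∨ (r = ⊤ ∧ R = ⊤))
    (hg : MemLp ((Metric.eball x R).indicator g) p' volume)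
    (hsα : (p'⁻¹).toReal - α / (d : ℝ) < (s'⁻¹).toReal) :
    MemLp ((Metric.eball x r).indicator f) s' volume := by
  obtain ⟨ε, hε, hεR⟩ := exists_pos_add_ofReal_le hrR
  have hps' : p ≤ s' := hpp'.le.trans hps
  have hp1 : 1 ≤ p' := hp.trans hpp'.le
  obtain ⟨q, hq, hpq, -⟩ := exists_young_exponent hp hps'
  obtain ⟨q', hq', hpq', hq'r⟩ := exists_young_exponent hp1 hps
  have hU : MemLp (localRepresentative α ε x R f g) s' volume :=
    ((memLp_stableSemigroup hd h0 h2 one_pos hp hps' hfg.memLp).sub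
      (hfg.memLp_image.convolution_mul hp hq (hp.trans hps') hpq
        (memLp_outerPotential hd h0 h2 hε hq))).sub
      (hg.convolution_mul hp1 hq' (hp.trans hps') hpq'
        (memLp_innerPotential hd h0 h2 ε hq' (by rw [hq'r]; linarith)))
  refine (hU.indicator Metric.isOpen_eball.measurableSet (s := Metric.eball x r)).ae_eq ?_
  filter_upwards [hfg.ae_eq_localRepresentative hd h0 h2 hp hεR (x := x)] with y hy
  by_cases hyr : y ∈ Metric.eball x r
  · rw [Set.indicator_of_mem hyr, Set.indicator_of_mem hyr, hy hyr]
  · rw [Set.indicator_of_notMem hyr, Set.indicator_of_notMem hyr]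

/-- Continuity of `g` at `x` makes it bounded on some ball, so the previous regularity result
applies with `p' = ∞`; the hypothesis `p < ∞` gives `p < p'`. -/
theorem HasFracLaplacian.exists_continuousAt (hd : 1 ≤ d) (h0 : 0 < α) (h2 : α < 2)
    (hp : 1 ≤ p) (hp_top : p < ⊤) (hfg : HasFracLaplacian α p f g)
    {x : EuclideanSpace ℝ (Fin d)} (hg : ContinuousAt g x) :
    ∃ f' : EuclideanSpace ℝ (Fin d) → ℂ, f' =ᵐ[volume] f ∧ ContinuousAt f' x := by
  have hbd : ∀ᶠ y in 𝓝 x, ‖g y‖ < ‖g x‖ + 1 :=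
    hg.norm.eventually (gt_mem_nhds (lt_add_one _))
  obtain ⟨R, hR, hRg⟩ := Metric.eventually_nhds_iff_ball.1 hbd
  have hgR : MemLp ((Metric.eball x (ENNReal.ofReal R)).indicator g) ⊤ volume := by
    refine memLp_top_of_bound (hfg.memLp_image.1.indicator Metric.isOpen_eball.measurableSet)
      (‖g x‖ + 1) (Eventually.of_forall fun y => ?_)
    rw [Metric.eball_ofReal]
    by_cases hy : y ∈ Metric.ball x R
    · rw [Set.indicator_of_mem hy]; exact (hRg y hy).le
    · rw [Set.indicator_of_notMem hy, norm_zero]; positivity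
  have hR2 : (0 : ℝ≥0∞) < ENNReal.ofReal (R / 2) := ENNReal.ofReal_pos.2 (by linarith)
  obtain ⟨f', hf', hc⟩ := hfg.exists_uniformContinuousOn hd h0 h2 hp hp_top
    (r := ENNReal.ofReal (R / 2)) (R := ENNReal.ofReal R) (Or.inl ⟨hR2,
      (ENNReal.ofReal_lt_ofReal_iff hR).2 (by linarith), ENNReal.ofReal_lt_top⟩) hgR
    ENNReal.ofReal_lt_top
  exact ⟨f', hf', hc.continuousOn.continuousAt (Metric.eball_mem_nhds x hR2)⟩

end Representation

theorem mainTheorem9 (d : ℕ) (hd : 1 ≤ d) (α : ℝ) (hα₀ : 0 < α) (hα₂ : α < 2)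
    (p : ℝ≥0∞) (hp : 1 ≤ p) (hp_top : p < ⊤)
    (f g : EuclideanSpace ℝ (Fin d) → ℂ) (hfg : HasFracLaplacian α p f g)
    (x : EuclideanSpace ℝ (Fin d)) :
    (ContinuousAt g x → ∃ f' : EuclideanSpace ℝ (Fin d) → ℂ, f' =ᵐ[volume] f ∧ ContinuousAt f' x) ∧
    (∀ (p' r R : ℝ≥0∞), p < p' → (0 < r ∧ r < R ∧ R < ⊤) ∨ (r = ⊤ ∧ R = ⊤) →
      MemLp ((Metric.eball x R).indicator g) p' volume →
      ENNReal.ofReal ((d : ℝ) / α) < p' →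
      ∃ f' : EuclideanSpace ℝ (Fin d) → ℂ,
        f' =ᵐ[volume] f ∧ UniformContinuousOn f' (Metric.eball x r)) ∧
    (∀ (p' s' r R : ℝ≥0∞), p < p' → p' ≤ s' → (0 < r ∧ r < R ∧ R < ⊤) ∨ (r = ⊤ ∧ R = ⊤) →
      MemLp ((Metric.eball x R).indicator g) p' volume →
      (p'⁻¹).toReal - α / (d : ℝ) < (s'⁻¹).toReal →
      MemLp ((Metric.eball x r).indicator f) s' volume) :=
  ⟨fun hg => hfg.exists_continuousAt hd hα₀ hα₂ hp hp_top hg,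
    fun _ _ _ hpp' hrR hg hpd => hfg.exists_uniformContinuousOn hd hα₀ hα₂ hp hpp' hrR hg hpd,
    fun _ _ _ _ hpp' hps hrR hg hs => hfg.memLp_indicator hd hα₀ hα₂ hp hpp' hps hrR hg hs⟩
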